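/- Let $K$ be an imaginary quadratic field with discriminant $-D$ ($D>0$), and let $\chi_D(n)=\left(\frac{-D}{n}\right)$ be the Kronecker symbol. For real $x$ put $$\Phi_D(x;\chi_D)=\phi_D\!\left(e^{2\pi x/\sqrt D};\chi_D\right),\qquad \phi_D(t;\chi_D)=\frac{\sum_{n=1}^{D-1}\chi_D(n)\,t^n}{1-t^D},$$ where the removable singularity of $\phi_D(\cdot;\chi_D)$ at $t=1$ (that is, at $x=0$) is filled by continuity. Then $\Phi_D(\cdot;\chi_D)$ is a Schwartz function on $\mathbb{R}$, and it is invariant under the Fourier transform: for every real $t$, $$\int_{-\infty}^{\infty}\Phi_D(x;\chi_D)\,e^{-2\pi i x t}\,dx=\Phi_D(t;\chi_D).$$ -/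

import Mathlib

open scoped FourierTransform Topology SchwartzMap

noncomputable section

/-- The Kronecker symbol `(a / n)` for all integers `a`, `n`, the extension of the Jacobi symbol
that is completely multiplicative in `n` (write `n = ± 2 ^ v * m` with `m` odd and positive), with
* `(a / 0) = 1` if `a = ± 1`, and `0` otherwise;
* `(a / -1) = -1` if `a < 0`, and `1` otherwise;
* `(a / 2) = 0` if `a` is even, `1` if `a ≡ ± 1 mod 8`, `-1` if `a ≡ ± 3 mod 8`,
  which is `ZMod.χ₈ a`;
* `(a / m)` the Jacobi symbol for odd positive `m`. -/
def kroneckerSym (a n : ℤ) : ℤ :=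
  if n = 0 then (if a = 1 ∨ a = -1 then 1 else 0)
  else (if n < 0 ∧ a < 0 then -1 else 1) *
    ZMod.χ₈ (a : ZMod 8) ^ padicValNat 2 n.natAbs *
    jacobiSym a (n.natAbs / 2 ^ padicValNat 2 n.natAbs)

/-- The quotient `(∑_{n=1}^{N-1} χ(n) t ^ n) / (1 - t ^ N)`. -/
def twistedQuotient (N : ℕ) (χ : ℤ → ℂ) (t : ℂ) : ℂ :=
  (∑ n ∈ Finset.Ico 1 N, χ n * t ^ n) / (1 - t ^ N)

open Classical in
/-- The `χ`-twisted geometric series `φ_N(t; χ) = (∑_{n=1}^{N-1} χ(n) t ^ n) / (1 - t ^ N)`.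
At `t = 1`, where for `∑_{n=1}^{N-1} χ(n) = 0` the quotient has a removable singularity,
its value is the limit of the quotient. -/
def phiTwisted (N : ℕ) (χ : ℤ → ℂ) (t : ℂ) : ℂ :=
  if t = 1 then Filter.limUnder (𝓝[≠] (1 : ℂ)) (twistedQuotient N χ) else twistedQuotient N χ t

/-- `Φ_N(x; χ) = φ_N(e ^ (2 π x / √N); χ)` for real `x`. -/
def PhiTwisted (N : ℕ) (χ : ℤ → ℂ) (x : ℝ) : ℂ :=
  phiTwisted N χ (Real.exp (2 * Real.pi * x / Real.sqrt N) : ℝ)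

/-- `χ_D(n) = (-D / n)`, the Kronecker symbol. -/
def chiD (D : ℕ) (n : ℤ) : ℂ := (kroneckerSym (-(D : ℤ)) n : ℂ)

end

/-! For `x > 0` evenness gives `Φ(x) = ∑ χ(n) q ^ n` with `q = exp (-2πx/√D)`. The cosine transform,
taken term by term, is `√D/(2π) ∑ χ(n) (1/(n+z) + 1/(n-z))` with `z = i√D t`. Grouping `n` modulo
`D` and using that `χ` is odd turns this into `√D/(2D) ∑ χ(a) cot (π(a+z)/D)`. Each cotangent is a
constant plus a multiple of `1/(1 - ζ ^ a w)`, with `ζ = e^(2πi/D)` and `w = e^(2πiz/D)`; after a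
geometric expansion, the sum over `a` is the finite Fourier transform of `χ`. If that transform is
`g χ`, the result is a multiple of `g φ(exp (-2πt/√D))`, and `g = i√D` makes the total constant 1
(`fourier_PhiTwisted_of_ne_zero`).

The arithmetic input is thus that the Kronecker symbol agrees on positive integers with an odd
`D`-periodic function of Gauss sum exactly `i√D` (`exists_isFourierEigen_chiD`). This needs `-D` to
be fundamental (`sq_eq_one_of_discr_eq_sq_mul`), the sign of the quadratic Gauss sum, obtained from
theta asymptotics at a cusp (`quadraticGaussSum_eq`), and quadratic reciprocity to glue coprime
moduli.

For the Schwartz property, `∑ χ(n) = 0` lets `1 - t` cancel, and the resulting exponential quotients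
lie in a span of rapidly decaying functions closed under derivation. -/

/-! ### Discriminants of imaginary quadratic fields are fundamental -/

section QuadraticField

open NumberField Module

variable {K : Type*} [Field K] [NumberField K]

/-- An algebraic integer `α` of a quadratic field with integral basis `b` satisfies
`(2 α - s) ^ 2 = n ^ 2 Δ`, with `n` the determinant of `(1, α)` in that basis. -/
theorem exists_sq_two_mul_sub_eq (b : Basis (Fin 2) ℤ (𝓞 K)) (α : 𝓞 K) :
    ∃ s q : ℤ, (2 * α - s) ^ 2 = ((s ^ 2 - 4 * q : ℤ) : 𝓞 K) ∧
      s ^ 2 - 4 * q = (b.repr 1 0 * b.repr α 1 - b.repr 1 1 * b.repr α 0) ^ 2 * discr K := by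
  set M := Algebra.leftMulMatrix b α with hM
  -- Cayley–Hamilton for multiplication by `α`; the witnesses `s`, `q` are the trace and norm of
  -- `α`.
  have hα : α ^ 2 - M.trace • α + M.det • 1 = 0 := by
    apply Algebra.leftMulMatrix_injective b
    rw [map_add, map_sub, map_smul, map_smul, map_pow, map_one, map_zero, ← hM]
    ext i j
    simp only [Matrix.add_apply, Matrix.sub_apply, Matrix.smul_apply, smul_eq_mul, pow_two,
      Matrix.mul_apply, Matrix.trace_fin_two, Matrix.det_fin_two, Fin.sum_univ_two,
      Matrix.zero_apply, Matrix.one_apply]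
    fin_cases i <;> fin_cases j <;> simp <;> ring
  have htr1 : Algebra.trace ℤ (𝓞 K) 1 = 2 := by
    have := Algebra.trace_algebraMap (R := ℤ) (S := 𝓞 K) 1
    rw [map_one] at this
    rw [this, finrank_eq_card_basis b]; simp
  have htrα : Algebra.trace ℤ (𝓞 K) α = M.trace := Algebra.trace_eq_matrix_trace b α
  have htrα2 : Algebra.trace ℤ (𝓞 K) (α * α) = M.trace ^ 2 - 2 * M.det := by
    have h2 : α * α = M.trace • α - M.det • 1 := by linear_combination hα
    rw [h2, map_sub, map_smul, map_smul, htr1, htrα, smul_eq_mul, smul_eq_mul]; ring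
  refine ⟨M.trace, M.det, ?_, ?_⟩
  · simp only [zsmul_eq_mul, mul_one] at hα
    generalize M.det = q at hα
    push_cast
    linear_combination 4 * hα
  -- The discriminant of the family `(1, α)`, computed once from traces and once by change of basis.
  · have h := Algebra.discr_of_matrix_mulVec (A := ℤ) b
      !![b.repr 1 0, b.repr 1 1; b.repr α 0, b.repr α 1]
    have hv : (!![b.repr 1 0, b.repr 1 1; b.repr α 0, b.repr α 1].map (algebraMap ℤ (𝓞 K))).mulVec b
        = ![1, α] := by
      have h1 := b.sum_repr 1
      have h2 := b.sum_repr α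
      rw [Fin.sum_univ_two] at h1 h2
      ext i
      fin_cases i <;> simp [Matrix.mulVec, dotProduct, Fin.sum_univ_two, ← zsmul_eq_mul, h1, h2]
    rw [hv, discr_eq_discr, Matrix.det_fin_two_of, Algebra.discr_def, Matrix.det_fin_two] at h
    simp only [Algebra.traceMatrix_apply, Algebra.traceForm_apply, Matrix.cons_val_zero,
      Matrix.cons_val_one, mul_one, one_mul, htr1, htrα, htrα2] at h
    linear_combination h

/-- Otherwise `1 = 2β` with `β` integral, and the quadratic relation for `β` forces `1 - 2s + 4q =
0`, impossible by parity. -/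
theorem not_even_repr_one (b : Basis (Fin 2) ℤ (𝓞 K)) :
    ¬ (2 ∣ b.repr 1 0 ∧ 2 ∣ b.repr 1 1) := by
  rintro ⟨⟨u, hu⟩, ⟨v, hv⟩⟩
  have h1 := b.sum_repr 1
  rw [Fin.sum_univ_two, hu, hv] at h1
  set β : 𝓞 K := u • b 0 + v • b 1 with hβ
  have h2 : β * (2 : ℤ) = 1 := by
    rw [← h1, hβ]; simp only [zsmul_eq_mul]; push_cast; ring
  obtain ⟨s, q, hs, -⟩ := exists_sq_two_mul_sub_eq b β
  have h3 : ((1 - s) ^ 2 : ℤ) = s ^ 2 - 4 * q := by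
    have : (((1 - s) ^ 2 : ℤ) : 𝓞 K) = ((s ^ 2 - 4 * q : ℤ) : 𝓞 K) := by
      rw [← hs]; push_cast at h2 ⊢; rw [mul_comm 2 β, h2]
    exact_mod_cast this
  have h5 : 1 - 2 * s + 4 * q = 0 := by linear_combination h3
  omega

/-- For `α = b 0` and `α = b 1` the determinant of `(1, α)` is, up to sign, a coordinate of `1`. One
coordinate is odd, and its square is 1 modulo 4, so the discriminant is congruent to a square. -/
theorem discr_quadratic_mod_four (b : Basis (Fin 2) ℤ (𝓞 K)) :
    discr K % 4 = 0 ∨ discr K % 4 = 1 := by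
  have key : ∀ u s q : ℤ, ¬ 2 ∣ u → s ^ 2 - 4 * q = u ^ 2 * discr K →
      discr K % 4 = 0 ∨ discr K % 4 = 1 := by
    intro u s q hu h
    obtain ⟨k, rfl⟩ : ∃ k, u = 2 * k + 1 := ⟨u / 2, by omega⟩
    have hs : s ^ 2 % 4 = 0 ∨ s ^ 2 % 4 = 1 := by
      rcases Int.even_or_odd' s with ⟨c, rfl | rfl⟩
      · left; ring_nf; omega
      · right; ring_nf; omega
    have : discr K = s ^ 2 + 4 * (-q - (k ^ 2 + k) * discr K) := by linear_combination -h
    omega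
  obtain ⟨s, q, -, h⟩ := exists_sq_two_mul_sub_eq b (b 0)
  obtain ⟨s', q', -, h'⟩ := exists_sq_two_mul_sub_eq b (b 1)
  simp at h h'
  by_cases hv : 2 ∣ b.repr 1 1
  · have hu : ¬ 2 ∣ b.repr 1 0 := fun hu => not_even_repr_one b ⟨hu, hv⟩
    exact key _ _ _ hu h'
  · exact key _ _ _ hv h

theorem exists_sq_eq_discr (b : Basis (Fin 2) ℤ (𝓞 K)) : ∃ γ : K, γ ^ 2 = (discr K : K) := by
  have key : ∀ (u : ℤ) (α : 𝓞 K) (s q : ℤ), u ≠ 0 →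
      (2 * α - s) ^ 2 = ((s ^ 2 - 4 * q : ℤ) : 𝓞 K) → s ^ 2 - 4 * q = u ^ 2 * discr K →
      ∃ γ : K, γ ^ 2 = (discr K : K) := by
    intro u α s q hu h1 h2
    refine ⟨(2 * α - s) / u, ?_⟩
    have hu' : (u : K) ≠ 0 := by exact_mod_cast hu
    rw [h2] at h1
    have h3 := congrArg (algebraMap (𝓞 K) K) h1
    simp only [map_pow, map_sub, map_mul, map_ofNat, map_intCast, Int.cast_mul, Int.cast_pow] at h3
    rw [div_pow, div_eq_iff (pow_ne_zero _ hu')]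
    linear_combination h3
  obtain ⟨s, q, h1, h⟩ := exists_sq_two_mul_sub_eq b (b 0)
  obtain ⟨s', q', h1', h'⟩ := exists_sq_two_mul_sub_eq b (b 1)
  simp at h h'
  by_cases hv : b.repr 1 1 = 0
  · have hu : b.repr 1 0 ≠ 0 := fun hu => not_even_repr_one b ⟨by simp [hu], by simp [hv]⟩
    exact key _ _ _ _ hu h1' h'
  · exact key _ _ _ _ hv h1 h

/-- The discriminant of an imaginary quadratic field is a fundamental discriminant. -/
theorem sq_eq_one_of_discr_eq_sq_mul (b : Basis (Fin 2) ℤ (𝓞 K)) (hneg : discr K < 0)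
    {f d : ℤ} (hfd : discr K = f ^ 2 * d) (hd : d % 4 = 0 ∨ d % 4 = 1) : f ^ 2 = 1 := by
  obtain ⟨γ, hγ⟩ := exists_sq_eq_discr b
  have hirr : ∀ r : ℚ, γ ≠ r := by
    rintro r rfl
    have : r ^ 2 = (discr K : ℚ) := by exact_mod_cast hγ
    have h2 : (discr K : ℚ) < 0 := by exact_mod_cast hneg
    nlinarith [sq_nonneg r]
  have hf : f ≠ 0 := by rintro rfl; simp at hfd; exact NumberField.discr_ne_zero K hfd
  have hf' : (f : K) ≠ 0 := by exact_mod_cast hf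
  have hd0 : d ≠ 0 := by rintro rfl; simp at hfd; exact NumberField.discr_ne_zero K hfd
  have hγd : (γ / f) ^ 2 = (d : K) := by
    rw [div_pow, hγ, div_eq_iff (pow_ne_zero _ hf'), hfd]; push_cast; ring
  obtain ⟨c, hc⟩ : ∃ c : ℤ, d ^ 2 - d = 4 * c := by
    rcases hd with h | h
    · obtain ⟨k, rfl⟩ : ∃ k, d = 4 * k := ⟨d / 4, by omega⟩
      exact ⟨4 * k ^ 2 - k, by ring⟩
    · obtain ⟨k, rfl⟩ : ∃ k, d = 4 * k + 1 := ⟨d / 4, by omega⟩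
      exact ⟨4 * k ^ 2 + k, by ring⟩
  have hc' : (d : K) ^ 2 - d = 4 * c := by exact_mod_cast hc
  -- `γ / f` is a square root of `d`, so `x` is a root of `X² - dX + (d² - d)/4`, which is integral
  -- by the congruence on `d`.
  set x : K := (d + γ / f) / 2 with hx
  have hxint : IsIntegral ℤ x := by
    refine ⟨Polynomial.X ^ 2 - Polynomial.C (d : ℤ) * Polynomial.X + Polynomial.C (c : ℤ), ?_, ?_⟩
    · monicity!
    · simp only [Polynomial.eval₂_add, Polynomial.eval₂_sub, Polynomial.eval₂_mul,
        Polynomial.eval₂_pow, Polynomial.eval₂_X, Polynomial.eval₂_C, hx]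
      simp only [eq_intCast]
      linear_combination (1 / 4 : K) * hγd - (1 / 4 : K) * hc'
  obtain ⟨α, hα⟩ : ∃ α : 𝓞 K, (α : K) = x := ⟨⟨x, hxint⟩, rfl⟩
  obtain ⟨s, q, h1, h2⟩ := exists_sq_two_mul_sub_eq b α
  set n := b.repr 1 0 * b.repr α 1 - b.repr 1 1 * b.repr α 0 with hn
  rw [h2] at h1
  have h3 := congrArg (algebraMap (𝓞 K) K) h1
  simp only [map_pow, map_sub, map_mul, map_ofNat, map_intCast, hα, hfd, hx] at h3
  push_cast at h3
  have h4 : (((d - s) ^ 2 + d - n ^ 2 * (f ^ 2 * d) : ℤ) : K) + 2 * ((d - s : ℤ) : K) * (γ / f) = 0 := by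
    push_cast
    linear_combination h3 - hγd
  -- Since `γ` is irrational, its coefficient `d - s` must vanish; what remains is `f² n² = 1`.
  by_cases hds : d - s = 0
  · rw [hds] at h4
    have h5 : (0 : ℤ) ^ 2 + d - n ^ 2 * (f ^ 2 * d) = 0 := by
      have : (((0 : ℤ) ^ 2 + d - n ^ 2 * (f ^ 2 * d) : ℤ) : K) = 0 := by
        simpa using h4
      exact_mod_cast this
    have h6 : f ^ 2 * n ^ 2 = 1 := by
      apply mul_left_cancel₀ hd0
      linear_combination -h5
    exact Int.eq_one_of_mul_eq_one_right (sq_nonneg f) h6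
  · exfalso
    refine hirr (-((d - s) ^ 2 + d - n ^ 2 * (f ^ 2 * d) : ℤ) * f / (2 * (d - s : ℤ)) : ℚ) ?_
    have hds' : ((d - s : ℤ) : K) ≠ 0 := by exact_mod_cast hds
    rw [Rat.cast_div, Rat.cast_mul, Rat.cast_mul, Rat.cast_neg, Rat.cast_intCast, Rat.cast_intCast,
      Rat.cast_intCast, Rat.cast_ofNat, eq_div_iff (mul_ne_zero two_ne_zero hds')]
    have : γ = γ / f * f := by field_simp
    rw [this]
    linear_combination (f : K) * h4

end QuadraticField

/-! ### The quadratic Gauss sum, with its sign, from theta functions -/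

section QuadraticGaussSum

open Complex Filter Finset

/-- For real `x` the `n`-th term has norm `exp (-π n² Im w)`: only `n = 0` survives, with the terms
at `w = i` as a dominating series. -/
theorem tendsto_jacobiTheta₂_one {ι : Type*} {l : Filter ι} [l.IsCountablyGenerated]
    (x : ℝ) {w : ι → ℂ} (hw : Tendsto (fun i => (w i).im) l atTop) :
    Tendsto (fun i => jacobiTheta₂ x (w i)) l (𝓝 1) := by
  have h1 : (1 : ℂ) = ∑' n : ℤ, if n = 0 then 1 else 0 := by rw [tsum_ite_eq]
  rw [h1]
  have hs : Summable fun n : ℤ => ‖jacobiTheta₂_term n 0 I‖ :=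
    ((summable_jacobiTheta₂_term_iff 0 I).2 (by simp)).norm
  refine tendsto_tsum_of_dominated_convergence hs (fun n => ?_) ?_
  · by_cases hn : n = 0
    · subst hn
      simpa [jacobiTheta₂_term] using tendsto_const_nhds
    · rw [if_neg hn, tendsto_zero_iff_norm_tendsto_zero]
      simp only [norm_jacobiTheta₂_term, ofReal_im, mul_zero, sub_zero]
      refine Real.tendsto_exp_atBot.comp ?_
      have : 0 < (n : ℝ) ^ 2 := by positivity
      exact hw.const_mul_atTop_of_neg (by nlinarith [Real.pi_pos])
  · filter_upwards [hw.eventually_ge_atTop 1] with i hi n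
    simp only [norm_jacobiTheta₂_term, ofReal_im, mul_zero, sub_zero, zero_im, I_im]
    apply Real.exp_le_exp.2
    have : 0 ≤ Real.pi * (n : ℝ) ^ 2 := by positivity
    nlinarith

/-- Poisson summation for a Gaussian twisted by a periodic function. -/
theorem tsum_periodic_mul_gaussian {N : ℕ} (hN : 0 < N) {f : ℤ → ℂ}
    (hf : ∀ n, f (n + N) = f n) {w : ℂ} (hw : 0 < w.im) :
    ∑' n : ℤ, f n * cexp (Real.pi * I * n ^ 2 * w) =
      1 / (-I * (N ^ 2 * w)) ^ (1 / 2 : ℂ) *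
        ∑ r ∈ range N, f r * jacobiTheta₂ ((r / N : ℝ) : ℂ) (-1 / (N ^ 2 * w)) := by
  have hN' : (N : ℂ) ≠ 0 := by exact_mod_cast hN.ne'
  have hw0 : w ≠ 0 := by rintro rfl; simp at hw
  have him : 0 < ((N : ℂ) ^ 2 * w).im := by
    have : (N : ℂ) ^ 2 * w = ((N ^ 2 : ℝ) : ℂ) * w := by push_cast; rfl
    rw [this, im_ofReal_mul]; positivity
  have hper : ∀ (k : ℤ) (r : ℤ), f (N * k + r) = f r := by
    intro k r
    have : Function.Periodic f (N : ℤ) := hf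
    have := this.int_mul k r
    rwa [add_comm, mul_comm] at this
  -- On the class `n = N k + r` the Gaussian sums to a theta function of modulus `N² w`, to which
  -- the functional equation applies.
  have hcls : ∀ r ∈ range N, HasSum
      (fun n : ℤ => if n % N = r then f n * cexp (Real.pi * I * n ^ 2 * w) else 0)
      (f r * (1 / (-I * (N ^ 2 * w)) ^ (1 / 2 : ℂ) *
        jacobiTheta₂ ((r / N : ℝ) : ℂ) (-1 / (N ^ 2 * w)))) := by
    intro r hr
    rw [mem_range] at hr
    have hinj : Function.Injective (fun k : ℤ => (N : ℤ) * k + r) := by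
      intro a b hab
      have : (N : ℤ) * a = N * b := by simpa using hab
      exact mul_left_cancel₀ (by exact_mod_cast hN.ne') this
    rw [← hinj.hasSum_iff]
    · have hmod : ∀ k : ℤ, ((N : ℤ) * k + r) % N = r := fun k => by
        rw [Int.add_comm, Int.add_mul_emod_self_left]
        exact Int.emod_eq_of_lt (by positivity) (by exact_mod_cast hr)
      have h1 := (hasSum_jacobiTheta₂_term (N * r * w) him).mul_left
        (f r * cexp (Real.pi * I * r ^ 2 * w))
      have h2 := jacobiTheta₂_functional_equation (N * r * w) (N ^ 2 * w)
      have e1 : (N * r * w : ℂ) / (N ^ 2 * w) = ((r / N : ℝ) : ℂ) := by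
        push_cast; field_simp
      have e2 : (-Real.pi * I * (N * r * w) ^ 2 / (N ^ 2 * w) : ℂ) =
          -(Real.pi * I * r ^ 2 * w) := by field_simp
      rw [e1, e2, exp_neg] at h2
      rw [h2] at h1
      have hval : f r * (1 / (-I * (N ^ 2 * w)) ^ (1 / 2 : ℂ) *
          jacobiTheta₂ ((r / N : ℝ) : ℂ) (-1 / (N ^ 2 * w))) =
          f r * cexp (Real.pi * I * r ^ 2 * w) * (1 / (-I * (N ^ 2 * w)) ^ (1 / 2 : ℂ) *
            (cexp (Real.pi * I * r ^ 2 * w))⁻¹ *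
            jacobiTheta₂ ((r / N : ℝ) : ℂ) (-1 / (N ^ 2 * w))) := by
        have := exp_ne_zero (Real.pi * I * r ^ 2 * w)
        field_simp
      rw [hval]
      refine h1.congr_fun fun k => ?_
      simp only [Function.comp, hmod, if_true, hper, jacobiTheta₂_term]
      rw [mul_assoc (f r), ← exp_add]
      congr 2
      push_cast; ring
    · intro n hn
      rw [if_neg]
      intro h
      exact hn ⟨n / N, by simp only; rw [← h]; exact Int.mul_ediv_add_emod n N⟩
  have hsum := hasSum_sum hcls
  have hfun : ∀ n : ℤ, (∑ r ∈ range N,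
      if n % N = r then f n * cexp (Real.pi * I * n ^ 2 * w) else 0) =
      f n * cexp (Real.pi * I * n ^ 2 * w) := by
    intro n
    have h0 := Int.emod_nonneg n (b := N) (by omega)
    have h1 := Int.emod_lt_of_pos n (b := N) (by omega)
    rw [sum_eq_single (n % N).toNat]
    · rw [if_pos (by omega)]
    · intro r _ hr
      rw [if_neg (by omega)]
    · intro h
      exact absurd (mem_range.2 (by omega)) h
  simp only [hfun] at hsum
  rw [hsum.tsum_eq, mul_sum]
  exact sum_congr rfl fun r _ => by ring

theorem ofReal_pos_mul_cpow {r : ℝ} (hr : 0 < r) {x : ℂ} (hx : x ≠ 0) (c : ℂ) :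
    (r * x : ℂ) ^ c = (r : ℂ) ^ c * x ^ c := by
  have hr' : (r : ℂ) ≠ 0 := by exact_mod_cast hr.ne'
  rw [cpow_def_of_ne_zero (mul_ne_zero hr' hx), cpow_def_of_ne_zero hr', cpow_def_of_ne_zero hx,
    log_ofReal_mul hr hx, ← exp_add, add_mul, ofReal_log hr.le]

/-- Both sides come from `θ(τ)` at `τ = 2/N + i s²`, near the cusp `2/N`. Directly, the phase
`e^(2πi n²/N)` has period `N`; after `τ ↦ -1/τ = -N/2 + δ`, the phase `e^(-πi n² N/2)` has period 2.
-/
theorem quadraticGaussSum_theta_identity {N : ℕ} (hN : 0 < N) {s : ℝ} (hs : 0 < s) :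
    ∑ r ∈ range N, cexp (2 * Real.pi * I * r ^ 2 / N) *
        jacobiTheta₂ ((r / N : ℝ) : ℂ) (-1 / (N ^ 2 * (I * s ^ 2))) =
      N / ((-I * (2 / N + I * s ^ 2)) ^ (1 / 2 : ℂ) *
        (2 * N / (2 / N + I * s ^ 2)) ^ (1 / 2 : ℂ)) *
        ∑ r ∈ range 2, cexp (-(Real.pi * I * r ^ 2 * N / 2)) *
          jacobiTheta₂ ((r / (2 : ℕ) : ℝ) : ℂ)
            (-1 / ((2 : ℕ) ^ 2 * (I * s ^ 2 * N / 2 / (2 / N + I * s ^ 2)))) := by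
  set τ : ℂ := 2 / N + I * s ^ 2 with hτ
  have hNR : (0 : ℝ) < N := by exact_mod_cast hN
  have hN' : (N : ℂ) ≠ 0 := by exact_mod_cast hN.ne'
  have hsC : (s : ℂ) ≠ 0 := by exact_mod_cast hs.ne'
  have hτim : τ.im = s ^ 2 := by
    have : τ = ((2 / N : ℝ) : ℂ) + ((s ^ 2 : ℝ) : ℂ) * I := by rw [hτ]; push_cast; ring
    rw [this, add_im, ofReal_im, mul_I_im, ofReal_re, zero_add]
  have hτ0 : τ ≠ 0 := by
    intro h; rw [h, zero_im] at hτim; exact (pow_pos hs 2).ne hτim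
  set δ : ℂ := I * s ^ 2 * N / 2 / τ with hδ
  have hδeq : -1 / τ = -(N / 2) + δ := by
    rw [hδ]; field_simp; rw [hτ]; field_simp; ring
  have hinv : -1 / τ = ((-τ)⁻¹) := by rw [inv_neg, neg_div, one_div]
  have hδim : 0 < δ.im := by
    have h1 : δ.im = (-1 / τ).im := by
      rw [hδeq]
      have : -((N : ℂ) / 2) = ((-(N / 2) : ℝ) : ℂ) := by push_cast; ring
      rw [this, add_im, ofReal_im, zero_add]
    rw [h1, hinv, inv_im, neg_im, neg_neg, hτim]
    have : 0 < normSq (-τ) := normSq_pos.2 (neg_ne_zero.2 hτ0)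
    positivity
  have hIim : 0 < (I * (s : ℂ) ^ 2).im := by
    have : I * (s : ℂ) ^ 2 = ((s ^ 2 : ℝ) : ℂ) * I := by push_cast; ring
    rw [this, mul_I_im, ofReal_re]; positivity
  have hA := tsum_periodic_mul_gaussian hN (f := fun n => cexp (2 * Real.pi * I * n ^ 2 / N))
    (fun n => by
      rw [exp_eq_exp_iff_exists_int]
      refine ⟨2 * n + N, ?_⟩
      push_cast; field_simp; ring) hIim
  have hB := tsum_periodic_mul_gaussian (N := 2) (by norm_num)
    (f := fun n => cexp (-(Real.pi * I * n ^ 2 * N / 2)))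
    (fun n => by
      rw [exp_eq_exp_iff_exists_int]
      refine ⟨-(n + 1) * N, ?_⟩
      push_cast; ring) hδim
  have hL : ∑' n : ℤ, cexp (2 * Real.pi * I * n ^ 2 / N) * cexp (Real.pi * I * n ^ 2 * (I * s ^ 2))
      = jacobiTheta₂ 0 τ := by
    rw [jacobiTheta₂]
    refine tsum_congr fun n => ?_
    rw [jacobiTheta₂_term, ← exp_add, hτ]
    congr 1; ring
  have hR : ∑' n : ℤ, cexp (-(Real.pi * I * n ^ 2 * N / 2)) * cexp (Real.pi * I * n ^ 2 * δ)
      = jacobiTheta₂ 0 (-1 / τ) := by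
    rw [jacobiTheta₂]
    refine tsum_congr fun n => ?_
    rw [jacobiTheta₂_term, ← exp_add, hδeq]
    congr 1; ring
  have hF := jacobiTheta₂_functional_equation 0 τ
  rw [hL] at hA
  rw [hR] at hB
  simp only [Int.cast_natCast] at hA hB
  rw [zero_div, hA, hB] at hF
  have e1 : (-I * (N ^ 2 * (I * s ^ 2)) : ℂ) ^ (1 / 2 : ℂ) = N * s := by
    have : (-I * (N ^ 2 * (I * s ^ 2)) : ℂ) = (((N * s : ℝ) : ℂ)) ^ 2 := by
      push_cast
      linear_combination (-(N : ℂ) ^ 2 * s ^ 2) * I_sq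
    rw [this, one_div, sq_cpow_two_inv (by rw [ofReal_re]; positivity)]
    push_cast; rfl
  have e2 : (-I * ((2 : ℕ) ^ 2 * δ) : ℂ) ^ (1 / 2 : ℂ) = s * (2 * N / τ) ^ (1 / 2 : ℂ) := by
    have : (-I * ((2 : ℕ) ^ 2 * δ) : ℂ) = ((s ^ 2 : ℝ) : ℂ) * (2 * N / τ) := by
      rw [hδ]; push_cast
      linear_combination (-2 * (N : ℂ) * s ^ 2 / τ) * I_sq
    rw [this, ofReal_pos_mul_cpow (by positivity) (div_ne_zero (by simpa using hN') hτ0), one_div,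
      ofReal_pow, sq_cpow_two_inv (by simpa using hs)]
  rw [e1, e2] at hF
  have hc1 : (-I * τ) ^ (1 / 2 : ℂ) ≠ 0 := by
    rw [Ne, cpow_eq_zero_iff]; simp [hτ0]
  have hc2 : (2 * N / τ) ^ (1 / 2 : ℂ) ≠ 0 := by
    rw [Ne, cpow_eq_zero_iff]; simp [hτ0, hN']
  have hz : cexp (-Real.pi * I * 0 ^ 2 / τ) = 1 := by simp
  rw [hz] at hF
  generalize (∑ r ∈ range N, cexp (2 * Real.pi * I * r ^ 2 / N) *
        jacobiTheta₂ ((r / N : ℝ) : ℂ) (-1 / (N ^ 2 * (I * s ^ 2)))) = A at hF ⊢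
  generalize (∑ r ∈ range 2, cexp (-(Real.pi * I * r ^ 2 * N / 2)) *
          jacobiTheta₂ ((r / (2 : ℕ) : ℝ) : ℂ) (-1 / ((2 : ℕ) ^ 2 * δ))) = B at hF ⊢
  field_simp at hF ⊢
  linear_combination hF

/-- As `s → 0⁺` every theta value tends to 1, which leaves a Landsberg–Schaar reciprocity between
the sum modulo `N` and the two-term sum `1 + (-i) ^ N`. -/
theorem quadraticGaussSum_eq {N : ℕ} (hN : 0 < N) :
    ∑ r ∈ range N, cexp (2 * Real.pi * I * r ^ 2 / N) =
      (Real.sqrt N) * (1 + (-I) ^ N) * (1 + I) / 2 := by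
  have hNR : (0 : ℝ) < N := by exact_mod_cast hN
  have hN' : (N : ℂ) ≠ 0 := by exact_mod_cast hN.ne'
  have hinv : Tendsto (fun s : ℝ => (s ^ 2)⁻¹) (𝓝[>] 0) atTop := by
    have h1 : Tendsto (fun s : ℝ => s⁻¹) (𝓝[>] 0) atTop := tendsto_inv_nhdsGT_zero
    simpa [Function.comp_def] using (tendsto_pow_atTop (α := ℝ) (two_ne_zero)).comp h1
  have hpos : ∀ᶠ s : ℝ in 𝓝[>] 0, 0 < s := self_mem_nhdsWithin
  have hL : Tendsto (fun s : ℝ => ∑ r ∈ range N, cexp (2 * Real.pi * I * r ^ 2 / N) *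
        jacobiTheta₂ ((r / N : ℝ) : ℂ) (-1 / (N ^ 2 * (I * s ^ 2)))) (𝓝[>] 0)
      (𝓝 (∑ r ∈ range N, cexp (2 * Real.pi * I * r ^ 2 / N) * 1)) := by
    refine tendsto_finsetSum _ fun r _ => (tendsto_jacobiTheta₂_one _ ?_).const_mul _
    refine (hinv.const_mul_atTop (show (0 : ℝ) < 1 / N ^ 2 by positivity)).congr' ?_
    filter_upwards [hpos] with s hs
    have hsC : (s : ℂ) ≠ 0 := by exact_mod_cast hs.ne'
    have : (-1 / (N ^ 2 * (I * s ^ 2)) : ℂ) = ((1 / N ^ 2 * (s ^ 2)⁻¹ : ℝ) : ℂ) * I := by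
      push_cast
      field_simp
      simp
    rw [this, mul_I_im, ofReal_re]
  have hR : Tendsto (fun s : ℝ => ∑ r ∈ range 2, cexp (-(Real.pi * I * r ^ 2 * N / 2)) *
          jacobiTheta₂ ((r / (2 : ℕ) : ℝ) : ℂ)
            (-1 / ((2 : ℕ) ^ 2 * (I * s ^ 2 * N / 2 / (2 / N + I * s ^ 2))))) (𝓝[>] 0)
      (𝓝 (∑ r ∈ range 2, cexp (-(Real.pi * I * r ^ 2 * N / 2)) * 1)) := by
    refine tendsto_finsetSum _ fun r _ => (tendsto_jacobiTheta₂_one _ ?_).const_mul _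
    refine (hinv.const_mul_atTop (show (0 : ℝ) < 1 / N ^ 2 by positivity)).congr' ?_
    filter_upwards [hpos] with s hs
    have hsC : (s : ℂ) ≠ 0 := by exact_mod_cast hs.ne'
    -- Up to the real shift `-1/(2N)`, this is the modulus occurring on the other side.
    have : (-1 / ((2 : ℕ) ^ 2 * (I * s ^ 2 * N / 2 / (2 / N + I * s ^ 2))) : ℂ) =
        ((1 / N ^ 2 * (s ^ 2)⁻¹ : ℝ) : ℂ) * I + ((-(1 / (2 * N)) : ℝ) : ℂ) := by
      push_cast
      have hT0 : (2 / N + I * s ^ 2 : ℂ) ≠ 0 := by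
        intro h
        have h1 : (2 / N + I * s ^ 2 : ℂ) = ((2 / N : ℝ) : ℂ) + ((s ^ 2 : ℝ) : ℂ) * I := by
          push_cast; ring
        have h2 := congrArg im (h1.symm.trans h)
        rw [add_im, ofReal_im, mul_I_im, ofReal_re, zero_add, zero_im] at h2
        exact (pow_pos hs 2).ne' h2
      have hT : (N : ℂ) * (2 / N + I * s ^ 2) = 2 + N * I * s ^ 2 := by field_simp
      generalize (2 / N + I * s ^ 2 : ℂ) = T at hT0 hT
      field_simp
      linear_combination -hT - (2 : ℂ) * I_sq
    rw [this, add_im, ofReal_im, mul_I_im, ofReal_re, add_zero]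
  have hτ : Tendsto (fun s : ℝ => (2 / N + I * s ^ 2 : ℂ)) (𝓝[>] 0) (𝓝 (2 / N)) := by
    have : Continuous fun s : ℝ => (2 / N + I * s ^ 2 : ℂ) := by fun_prop
    have := this.tendsto 0
    simp only [ofReal_zero, ne_eq, OfNat.ofNat_ne_zero, not_false_eq_true, zero_pow, mul_zero,
      add_zero] at this
    exact this.mono_left nhdsWithin_le_nhds
  have h2N : (2 / N : ℂ) ≠ 0 := div_ne_zero two_ne_zero hN'
  have hc1 : Tendsto (fun s : ℝ => (-I * (2 / N + I * s ^ 2) : ℂ) ^ (1 / 2 : ℂ)) (𝓝[>] 0)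
      (𝓝 ((-I * (2 / N)) ^ (1 / 2 : ℂ))) := by
    refine ((continuousAt_cpow_const ?_).tendsto).comp (hτ.const_mul _)
    right
    have : (-I * (2 / N) : ℂ) = ((-(2 / N) : ℝ) : ℂ) * I := by push_cast; ring
    rw [this]; simp [hN.ne']
  have hc2 : Tendsto (fun s : ℝ => (2 * N / (2 / N + I * s ^ 2) : ℂ) ^ (1 / 2 : ℂ)) (𝓝[>] 0)
      (𝓝 ((2 * N / (2 / N)) ^ (1 / 2 : ℂ))) := by
    refine ((continuousAt_cpow_const ?_).tendsto).comp (tendsto_const_nhds.div hτ h2N)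
    left
    have : (2 * N / (2 / N) : ℂ) = ((N ^ 2 : ℝ) : ℂ) := by push_cast; field_simp
    rw [this, ofReal_re]; positivity
  -- The principal root is the one with positive real part; this choice fixes the sign of the Gauss
  -- sum.
  have v1 : (-I * (2 / N) : ℂ) ^ (1 / 2 : ℂ) = (1 - I) / Real.sqrt N := by
    have hsq : ((Real.sqrt N : ℝ) : ℂ) ^ 2 = N := by
      rw [← ofReal_pow, Real.sq_sqrt hNR.le, ofReal_natCast]
    have : (-I * (2 / N) : ℂ) = ((1 - I) / Real.sqrt N) ^ 2 := by
      rw [div_pow, hsq]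
      field_simp
      linear_combination -I_sq
    rw [this, one_div, sq_cpow_two_inv]
    rw [div_ofReal_re]
    simp; positivity
  have v2 : (2 * N / (2 / N) : ℂ) ^ (1 / 2 : ℂ) = N := by
    have : (2 * N / (2 / N) : ℂ) = (N : ℂ) ^ 2 := by field_simp
    rw [this, one_div, sq_cpow_two_inv (by simpa using hN)]
  rw [v1] at hc1
  rw [v2] at hc2
  have hsqrt : ((Real.sqrt N : ℝ) : ℂ) ≠ 0 := by
    exact_mod_cast (Real.sqrt_pos.2 hNR).ne'
  have h1I : (1 - I : ℂ) ≠ 0 := by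
    intro h; have := congrArg re h; simp at this
  have hlim := ((tendsto_const_nhds (x := (N : ℂ))).div (hc1.mul hc2)
    (mul_ne_zero (div_ne_zero h1I hsqrt) hN')).mul hR
  have heq := tendsto_nhds_unique (hL.congr' (by
    filter_upwards [hpos] with s hs using quadraticGaussSum_theta_identity hN hs)) hlim
  simp only [mul_one] at heq
  rw [heq, sum_range_succ, sum_range_one]
  have hexp : cexp (-(Real.pi * I * (1 : ℕ) ^ 2 * N / 2)) = (-I) ^ N := by
    have : (-I : ℂ) = cexp (-(Real.pi / 2 * I)) := by rw [exp_neg, exp_pi_div_two_mul_I, inv_I]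
    rw [this, ← exp_nat_mul]
    congr 1; push_cast; ring
  rw [hexp]
  have h2 : (1 - I) * (1 + I) = 2 := by linear_combination -I_sq
  simp only [Nat.cast_zero, ne_eq, OfNat.ofNat_ne_zero, not_false_eq_true, zero_pow, mul_zero,
    zero_mul, zero_div, neg_zero, exp_zero]
  field_simp
  linear_combination -(1 + (-I) ^ N) * h2

end QuadraticGaussSum

/-! ### Eigenfunctions of the finite Fourier transform -/

section FourierEigen

open Complex Finset

/-- `ψ` is `N`-periodic and its finite Fourier transform modulo `N` is `g * ψ`. -/
def IsFourierEigen (N : ℕ) (ψ : ℤ → ℂ) (g : ℂ) : Prop :=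
  (∀ n, ψ (n + N) = ψ n) ∧
    ∀ j : ℤ, ∑ a ∈ range N, ψ a * cexp (2 * Real.pi * I * (a * j / N)) = g * ψ j

theorem apply_mul_add_of_periodic {N : ℕ} {f : ℤ → ℂ} (hf : ∀ n, f (n + N) = f n) (k r : ℤ) :
    f (N * k + r) = f r := by
  have h : Function.Periodic f (N : ℤ) := hf
  have := h.int_mul k r
  rwa [add_comm, mul_comm] at this

theorem sum_range_mul_of_coprime {N₁ N₂ : ℕ} (h₁ : 0 < N₁) (h₂ : 0 < N₂) (hc : N₁.Coprime N₂)
    {F : ℤ → ℂ} (hF : ∀ n, F (n + (N₁ * N₂ : ℕ)) = F n) :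
    ∑ a ∈ range (N₁ * N₂), F a = ∑ x ∈ range N₁, ∑ y ∈ range N₂, F (N₂ * x + N₁ * y) := by
  rw [← sum_product']
  symm
  have hmaps : Set.MapsTo (fun z : ℕ × ℕ => (N₂ * z.1 + N₁ * z.2) % (N₁ * N₂))
      (range N₁ ×ˢ range N₂ : Finset (ℕ × ℕ)) (range (N₁ * N₂) : Finset ℕ) := fun z _ => by
    simpa using Nat.mod_lt _ (Nat.mul_pos h₁ h₂)
  have hinj : Set.InjOn (fun z : ℕ × ℕ => (N₂ * z.1 + N₁ * z.2) % (N₁ * N₂))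
      (range N₁ ×ˢ range N₂ : Finset (ℕ × ℕ)) := by
    rintro ⟨x, y⟩ hz ⟨x', y'⟩ hz' h
    simp only [coe_product, Set.mem_prod, coe_range, Set.mem_Iio] at hz hz' h
    change _ ≡ _ [MOD N₁ * N₂] at h
    have hx : N₂ * x ≡ N₂ * x' [MOD N₁] := by
      have := h.of_mul_right N₂
      simpa [Nat.ModEq, Nat.add_mul_mod_self_left] using this
    have hy : N₁ * y ≡ N₁ * y' [MOD N₂] := by
      have := h.of_mul_left N₁
      simpa [Nat.ModEq, Nat.mul_add_mod] using this
    have hx' := Nat.ModEq.cancel_left_of_coprime hc hx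
    have hy' := Nat.ModEq.cancel_left_of_coprime hc.symm hy
    rw [Prod.mk.injEq]
    exact ⟨Nat.ModEq.eq_of_lt_of_lt hx' hz.1 hz'.1, Nat.ModEq.eq_of_lt_of_lt hy' hz.2 hz'.2⟩
  refine sum_nbij _ hmaps hinj (surjOn_of_injOn_of_card_le _ hmaps hinj (by simp)) ?_
  rintro ⟨x, y⟩ -
  have := apply_mul_add_of_periodic hF (((N₂ * x + N₁ * y) / (N₁ * N₂) : ℕ) : ℤ)
    (((N₂ * x + N₁ * y) % (N₁ * N₂) : ℕ) : ℤ)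
  simp only
  rw [← this, ← Nat.cast_mul (N₁ * N₂), ← Nat.cast_add, Nat.div_add_mod]
  push_cast
  rfl

/-- Under the Chinese remainder parametrization `a = N₂ x + N₁ y` the exponential splits into one
factor for each modulus, while `ψ₁` and `ψ₂` see `N₂ x` and `N₁ y`; multiplicativity extracts `ψ₁ N₂
* ψ₂ N₁`. -/
theorem IsFourierEigen.mul {N₁ N₂ : ℕ} (h₁ : 0 < N₁) (h₂ : 0 < N₂) (hc : N₁.Coprime N₂)
    {ψ₁ ψ₂ : ℤ → ℂ} {g₁ g₂ : ℂ} (hψ₁ : IsFourierEigen N₁ ψ₁ g₁) (hψ₂ : IsFourierEigen N₂ ψ₂ g₂)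
    (hm₁ : ∀ a b, ψ₁ (a * b) = ψ₁ a * ψ₁ b) (hm₂ : ∀ a b, ψ₂ (a * b) = ψ₂ a * ψ₂ b) :
    IsFourierEigen (N₁ * N₂) (fun n => ψ₁ n * ψ₂ n) (ψ₁ N₂ * ψ₂ N₁ * (g₁ * g₂)) := by
  have hN₁ : (N₁ : ℂ) ≠ 0 := by exact_mod_cast h₁.ne'
  have hN₂ : (N₂ : ℂ) ≠ 0 := by exact_mod_cast h₂.ne'
  have hper : ∀ n : ℤ, ψ₁ (n + (N₁ * N₂ : ℕ)) * ψ₂ (n + (N₁ * N₂ : ℕ)) = ψ₁ n * ψ₂ n := by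
    intro n
    have e1 := apply_mul_add_of_periodic hψ₁.1 N₂ n
    have e2 := apply_mul_add_of_periodic hψ₂.1 N₁ n
    rw [← e1, ← e2]
    push_cast
    rw [add_comm n, mul_comm (N₂ : ℤ)]
  refine ⟨hper, fun j => ?_⟩
  have hF : ∀ n : ℤ, (ψ₁ (n + (N₁ * N₂ : ℕ)) * ψ₂ (n + (N₁ * N₂ : ℕ))) *
      cexp (2 * Real.pi * I * ((n + (N₁ * N₂ : ℕ) : ℤ) * j / (N₁ * N₂ : ℕ))) =
      ψ₁ n * ψ₂ n * cexp (2 * Real.pi * I * (n * j / (N₁ * N₂ : ℕ))) := by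
    intro n
    rw [hper]
    congr 1
    rw [exp_eq_exp_iff_exists_int]
    refine ⟨j, ?_⟩
    push_cast; field_simp
  have := sum_range_mul_of_coprime h₁ h₂ hc
    (F := fun n : ℤ => ψ₁ n * ψ₂ n * cexp (2 * Real.pi * I * (n * j / (N₁ * N₂ : ℕ)))) hF
  simp only [Int.cast_natCast] at this
  rw [this]
  have hterm : ∀ x y : ℕ, ψ₁ (N₂ * x + N₁ * y) * ψ₂ (N₂ * x + N₁ * y) *
      cexp (2 * Real.pi * I * ((N₂ * x + N₁ * y : ℤ) * j / (N₁ * N₂ : ℕ))) =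
      ψ₁ N₂ * ψ₂ N₁ * ((ψ₁ x * cexp (2 * Real.pi * I * (x * j / N₁))) *
        (ψ₂ y * cexp (2 * Real.pi * I * (y * j / N₂)))) := by
    intro x y
    rw [apply_mul_add_of_periodic hψ₂.1, add_comm ((N₂ : ℤ) * x),
      apply_mul_add_of_periodic hψ₁.1, hm₁, hm₂]
    have : cexp (2 * Real.pi * I * ((N₁ * y + N₂ * x : ℤ) * j / (N₁ * N₂ : ℕ))) =
        cexp (2 * Real.pi * I * (x * j / N₁)) * cexp (2 * Real.pi * I * (y * j / N₂)) := by
      rw [← exp_add]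
      congr 1
      push_cast; field_simp; ring
    rw [this]; ring
  simp only [hterm, ← mul_sum, ← sum_mul, hψ₁.2 j, hψ₂.2 j]
  ring

theorem sum_range_zmod {N : ℕ} [NeZero N] (f : ZMod N → ℂ) :
    ∑ a ∈ range N, f a = ∑ x : ZMod N, f x := by
  refine sum_nbij' (fun a : ℕ => (a : ZMod N)) ZMod.val (by simp) ?_ ?_ (by simp) (by simp)
  · intro x _; simpa using ZMod.val_lt x
  · intro a ha; exact ZMod.val_cast_of_lt (by simpa using ha)

/-- The number of square roots of `a` is `1 + χ(a)`, so `∑ e(r²/p)` is the Gauss sum of the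
quadratic character. Scaling by a unit `j` brings out `χ(j)`; for `p ∣ j` both sides vanish because
`χ` is nontrivial. -/
theorem isFourierEigen_jacobiSym_prime {p : ℕ} (hp : p.Prime) (hp2 : p ≠ 2) :
    IsFourierEigen p (fun n => (jacobiSym n p : ℂ))
      (∑ r ∈ range p, cexp (2 * Real.pi * I * r ^ 2 / p)) := by
  have : Fact p.Prime := ⟨hp⟩
  refine ⟨fun n => ?_, fun j => ?_⟩
  · simp only
    rw [jacobiSym.mod_left (n + p), Int.add_emod_right, ← jacobiSym.mod_left]
  set χ : MulChar (ZMod p) ℂ := (quadraticChar (ZMod p)).ringHomComp (Int.castRingHom ℂ) with hχ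
  have hJ : ∀ n : ℤ, (jacobiSym n p : ℂ) = χ (n : ZMod p) := by
    intro n
    rw [← jacobiSym.legendreSym.to_jacobiSym]
    simp [hχ, legendreSym]
  have hχ1 : χ ≠ 1 := by
    intro h
    obtain ⟨a, ha⟩ := quadraticChar_exists_neg_one (F := ZMod p) (by rwa [ZMod.ringChar_zmod_n])
    have ha0 : IsUnit a := by
      rw [isUnit_iff_ne_zero]; rintro rfl; simp at ha
    have h1 := MulChar.one_apply (R' := ℂ) ha0
    rw [← h] at h1
    simp [hχ, ha] at h1
    norm_num at h1
  have hexp : ∀ (a : ℕ) (j : ℤ), cexp (2 * Real.pi * I * (a * j / p)) =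
      ZMod.stdAddChar ((a : ZMod p) * (j : ZMod p)) := by
    intro a j
    have := ZMod.stdAddChar_coe (N := p) (a * j)
    push_cast at this
    rw [this]
    congr 1; ring
  have hG : (∑ r ∈ range p, cexp (2 * Real.pi * I * r ^ 2 / p)) =
      gaussSum χ (ZMod.stdAddChar (N := p)) := by
    have h1 : ∀ r : ℕ, cexp (2 * Real.pi * I * r ^ 2 / p) =
        (fun x : ZMod p => ZMod.stdAddChar (x ^ 2)) r := by
      intro r
      have := hexp r r
      push_cast at this
      simp only
      rw [pow_two (r : ZMod p), ← this]
      congr 1; ring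
    simp only [h1]
    rw [sum_range_zmod (fun x : ZMod p => ZMod.stdAddChar (x ^ 2)), gaussSum]
    have h2 : ∑ a : ZMod p, (χ a + 1) * ZMod.stdAddChar a = ∑ x : ZMod p, ZMod.stdAddChar (x ^ 2) := by
      rw [← sum_fiberwise_of_maps_to (s := univ) (g := fun x : ZMod p => x ^ 2) (t := univ)
        (by simp) (fun x => ZMod.stdAddChar (x ^ 2))]
      refine sum_congr rfl fun a _ => ?_
      have h3 := quadraticChar_card_sqrts (F := ZMod p) (by rwa [ZMod.ringChar_zmod_n]) a
      have h4 : χ a + 1 = ((#{x : ZMod p | x ^ 2 = a} : ℕ) : ℂ) := by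
        have h5 : ((#{x : ZMod p | x ^ 2 = a} : ℕ) : ℤ) = quadraticChar (ZMod p) a + 1 := by
          rw [← h3]
          congr 2
          ext x; simp
        rw [← Int.cast_natCast, h5]
        simp [hχ]
      rw [h4, ← nsmul_eq_mul, ← sum_const]
      refine sum_congr rfl fun x hx => ?_
      rw [(mem_filter.1 hx).2]
    rw [← h2]
    simp only [add_mul, one_mul, sum_add_distrib]
    have h6 : ∑ x : ZMod p, ZMod.stdAddChar (N := p) x = 0 :=
      AddChar.sum_eq_zero_of_ne_one (by
        simpa [AddChar.mulShift_one] using ZMod.isPrimitive_stdAddChar p one_ne_zero)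
    rw [h6, add_zero]
  have hL : ∑ a ∈ range p, (jacobiSym a p : ℂ) * cexp (2 * Real.pi * I * (a * j / p)) =
      ∑ x : ZMod p, χ x * ZMod.stdAddChar (x * (j : ZMod p)) := by
    rw [← sum_range_zmod (fun x : ZMod p => χ x * ZMod.stdAddChar (x * (j : ZMod p)))]
    refine sum_congr rfl fun a _ => ?_
    rw [hexp, hJ]; simp
  simp only
  rw [hL, hG, hJ]
  by_cases hj : (j : ZMod p) = 0
  · simp only [hj, mul_zero, AddChar.map_zero_eq_one, mul_one, MulChar.map_zero]
    exact MulChar.sum_eq_zero_of_ne_one hχ1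
  · have h := gaussSum_mulShift χ (ZMod.stdAddChar (N := p)) (Units.mk0 _ hj)
    have hsq : χ j * χ j = 1 := by
      rw [← map_mul, ← pow_two]
      have h2 := quadraticChar_sq_one' hj
      simp [hχ, h2]
    rw [← h, Units.val_mk0, mul_comm (χ j * _), ← mul_assoc, hsq]
    simp [gaussSum, AddChar.mulShift_apply, mul_comm]

end FourierEigen

/-! ### Gauss sums for odd squarefree moduli and for moduli 4 and 8 -/

section FundamentalDiscriminant

open Complex Finset

/-- The argument of the quadratic Gauss sum modulo an odd `m`: `1` if `m ≡ 1 mod 4`, else `i`. -/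
noncomputable def gaussSign (m : ℕ) : ℂ := if m % 4 = 1 then 1 else I

theorem quadraticGaussSum_odd {N : ℕ} (hN : Odd N) :
    ∑ r ∈ range N, cexp (2 * Real.pi * I * r ^ 2 / N) = gaussSign N * Real.sqrt N := by
  rw [quadraticGaussSum_eq hN.pos, gaussSign]
  have h4 : (-I) ^ 4 = 1 := by rw [neg_pow, I_pow_four]; norm_num
  have hmod : (-I) ^ N = (-I) ^ (N % 4) := pow_eq_pow_mod N h4
  rw [hmod]
  rcases Nat.odd_mod_four_iff.1 (Nat.odd_iff.1 hN) with h | h <;> rw [h]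
  · rw [if_pos rfl]
    linear_combination (-(Real.sqrt N : ℂ) / 2) * I_sq
  · rw [if_neg (by norm_num)]
    linear_combination (-(Real.sqrt N : ℂ) / 2) * (I ^ 2 + I) * I_sq + Real.sqrt N * I_sq / 2

/-- Gluing coprime `a` and `b` introduces `(b/a)(a/b)`. By reciprocity this is the sign relating
`gaussSign a * gaussSign b` to `gaussSign (a * b)`: it offsets `i · i = -1` when both are 3 modulo
4. -/
theorem isFourierEigen_jacobiSym {m : ℕ} (hodd : Odd m) (hsq : Squarefree m) :
    IsFourierEigen m (fun n => (jacobiSym n m : ℂ)) (gaussSign m * Real.sqrt m) := by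
  induction m using Nat.recOnPosPrimePosCoprime with
  | zero => simp at hodd
  | one => exact ⟨fun n => by simp, fun j => by simp [gaussSign]⟩
  | prime_pow p n hp hn =>
    have hn1 : n = 1 := by
      exact ((Nat.squarefree_pow_iff hp.ne_one hn.ne').1 hsq).2
    subst hn1
    rw [pow_one] at *
    rw [← quadraticGaussSum_odd hodd]
    exact isFourierEigen_jacobiSym_prime hp (by rintro rfl; exact absurd hodd (by decide))
  | coprime a b ha hb hab iha ihb =>
    obtain ⟨hoa, hob⟩ := Nat.odd_mul.1 hodd
    have hsa := hsq.squarefree_of_dvd (dvd_mul_right a b)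
    have hsb := hsq.squarefree_of_dvd (dvd_mul_left b a)
    have h := (iha hoa hsa).mul (by omega) (by omega) hab (ihb hob hsb)
      (fun x y => by rw [jacobiSym.mul_left]; push_cast; rfl)
      (fun x y => by rw [jacobiSym.mul_left]; push_cast; rfl)
    have hfun : (fun n : ℤ => (jacobiSym n (a * b) : ℂ)) =
        fun n => (jacobiSym n a : ℂ) * (jacobiSym n b : ℂ) := by
      ext n
      rw [jacobiSym.mul_right' n (by omega) (by omega)]; push_cast; rfl
    have hsqrt : (Real.sqrt (a * b : ℕ) : ℂ) = Real.sqrt a * Real.sqrt b := by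
      rw [Nat.cast_mul, Real.sqrt_mul (by positivity), ofReal_mul]
    rw [hfun, hsqrt]
    convert h using 1
    have hq : (jacobiSym b a : ℂ) * (jacobiSym a b : ℂ) * (gaussSign a * gaussSign b) =
        gaussSign (a * b) := by
      have hsq1 : (jacobiSym b a : ℂ) * (jacobiSym b a : ℂ) = 1 := by
        have := jacobiSym.sq_one (a := b) (b := a) (by simpa [Int.gcd_natCast_natCast] using hab.symm)
        rw [← pow_two]; exact_mod_cast this
      unfold gaussSign
      rcases Nat.odd_mod_four_iff.1 (Nat.odd_iff.1 hoa) with h1 | h1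
      · rw [jacobiSym.quadratic_reciprocity_one_mod_four h1 hob, hsq1, Nat.mul_mod, h1]
        simp
      · rcases Nat.odd_mod_four_iff.1 (Nat.odd_iff.1 hob) with h2 | h2
        · rw [jacobiSym.quadratic_reciprocity_one_mod_four' hoa h2, hsq1, Nat.mul_mod, h1, h2]
          simp
        · rw [jacobiSym.quadratic_reciprocity_three_mod_four h1 h2, Nat.mul_mod, h1, h2]
          norm_num
          linear_combination hsq1
    rw [← hq]; ring

theorem isFourierEigen_of_forall_lt {N : ℕ} (hN : 0 < N) {ψ : ℤ → ℂ} {g : ℂ}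
    (hper : ∀ n, ψ (n + N) = ψ n) (h : ∀ r < N, ∑ a ∈ range N,
      ψ a * cexp (2 * Real.pi * I / N) ^ (a * r % N) = g * ψ r) : IsFourierEigen N ψ g := by
  refine ⟨hper, fun j => ?_⟩
  have hN' : (N : ℂ) ≠ 0 := by exact_mod_cast hN.ne'
  obtain ⟨r, hr⟩ : ∃ r : ℕ, j % N = r := ⟨(j % N).toNat, by
    have := Int.emod_nonneg j (b := N) (by omega); omega⟩
  have hrN : r < N := by
    have := Int.emod_lt_of_pos j (b := N) (by omega); omega
  have hj : j = N * (j / N) + r := by rw [← hr, Int.mul_ediv_add_emod]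
  have hψ : ψ j = ψ r := by rw [hj, apply_mul_add_of_periodic hper]
  rw [hψ, ← h r hrN]
  refine sum_congr rfl fun a _ => ?_
  have hone : cexp (2 * Real.pi * I / N) ^ N = 1 := by
    rw [← exp_nat_mul, mul_div_cancel₀ _ hN', exp_two_pi_mul_I]
  rw [← pow_eq_pow_mod _ hone, ← exp_nat_mul]
  congr 1
  rw [exp_eq_exp_iff_exists_int]
  refine ⟨a * (j / N), ?_⟩
  have hjC : (j : ℂ) = N * ((j / N : ℤ) : ℂ) + r := by exact_mod_cast congrArg (Int.cast (R := ℂ)) hj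
  rw [hjC]
  push_cast; field_simp; ring

theorem isFourierEigen_χ₄ : IsFourierEigen 4 (fun n => (ZMod.χ₄ (n : ZMod 4) : ℂ)) (2 * I) := by
  refine isFourierEigen_of_forall_lt (by norm_num) (fun n => ?_) fun r hr => ?_
  · have : ((4 : ℕ) : ZMod 4) = 0 := by decide
    push_cast at this ⊢
    simp only [this, add_zero]
  · have hz : cexp (2 * Real.pi * I / (4 : ℕ)) = I := by
      rw [show (2 * Real.pi * I / (4 : ℕ) : ℂ) = Real.pi / 2 * I by push_cast; ring,
        exp_pi_div_two_mul_I]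
    rw [hz]
    have c0 : ZMod.χ₄ 0 = 0 := by decide
    have c1 : ZMod.χ₄ 1 = 1 := by decide
    have c2 : ZMod.χ₄ 2 = 0 := by decide
    have c3 : ZMod.χ₄ 3 = -1 := by decide
    interval_cases r <;> simp [sum_range_succ, c0, c1, c2, c3, I_pow_three] <;> ring

/-- Writing `√8` as a polynomial in the eighth root of unity makes the checks modulo 8 polynomial
identities. -/
theorem zeta_eight : ∃ z : ℂ, cexp (2 * Real.pi * I / (8 : ℕ)) = z ∧ z ^ 2 = I ∧
    (Real.sqrt 8 : ℂ) = 2 * (z - z ^ 3) := by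
  refine ⟨_, rfl, ?_, ?_⟩
  · rw [← exp_nat_mul, show (2 : ℕ) * (2 * Real.pi * I / (8 : ℕ)) = Real.pi / 2 * I by
      push_cast; ring, exp_pi_div_two_mul_I]
  · have h : (Real.sqrt 8 : ℝ) = 2 * Real.sqrt 2 := by
      rw [show (8 : ℝ) = 2 ^ 2 * 2 by norm_num, Real.sqrt_mul (by norm_num),
        Real.sqrt_sq (by norm_num)]
    have hz : cexp (2 * Real.pi * I / (8 : ℕ)) = (Real.sqrt 2 / 2 : ℝ) * (1 + I) := by
      have : (2 * Real.pi * I / (8 : ℕ) : ℂ) = ((Real.pi / 4 : ℝ) : ℂ) * I := by push_cast; ring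
      rw [this, exp_mul_I, ← ofReal_cos, ← ofReal_sin, Real.cos_pi_div_four, Real.sin_pi_div_four]
      ring
    have hs : (Real.sqrt 2 : ℂ) ^ 2 = 2 := by
      rw [← ofReal_pow, Real.sq_sqrt (by norm_num)]; norm_num
    rw [hz, h]
    push_cast
    have h3 : (1 + I : ℂ) ^ 3 = 2 * I - 2 := by
      linear_combination (3 + I) * I_sq
    rw [mul_pow, h3]
    linear_combination ((Real.sqrt 2 : ℂ) / 2 * (I - 1)) * hs

theorem isFourierEigen_χ₈ :
    IsFourierEigen 8 (fun n => (ZMod.χ₈ (n : ZMod 8) : ℂ)) (Real.sqrt 8) := by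
  refine isFourierEigen_of_forall_lt (by norm_num) (fun n => ?_) fun r hr => ?_
  · have : ((8 : ℕ) : ZMod 8) = 0 := by decide
    push_cast at this ⊢
    simp only [this, add_zero]
  · obtain ⟨z, hz, hz2, h8⟩ := zeta_eight
    rw [hz, h8]
    have z4 : z ^ 4 = -1 := by linear_combination (z ^ 2 + I) * hz2 + I_sq
    have z5 : z ^ 5 = -z := by linear_combination z * z4
    have z6 : z ^ 6 = -z ^ 2 := by linear_combination z ^ 2 * z4
    have z7 : z ^ 7 = -z ^ 3 := by linear_combination z ^ 3 * z4
    have c0 : ZMod.χ₈ 0 = 0 := by decide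
    have c1 : ZMod.χ₈ 1 = 1 := by decide
    have c2 : ZMod.χ₈ 2 = 0 := by decide
    have c3 : ZMod.χ₈ 3 = -1 := by decide
    have c4 : ZMod.χ₈ 4 = 0 := by decide
    have c5 : ZMod.χ₈ 5 = -1 := by decide
    have c6 : ZMod.χ₈ 6 = 0 := by decide
    have c7 : ZMod.χ₈ 7 = 1 := by decide
    interval_cases r <;>
      simp [sum_range_succ, c0, c1, c2, c3, c4, c5, c6, c7, z4, z5, z6, z7] <;> ring

theorem isFourierEigen_χ₈' :
    IsFourierEigen 8 (fun n => (ZMod.χ₈' (n : ZMod 8) : ℂ)) (I * Real.sqrt 8) := by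
  refine isFourierEigen_of_forall_lt (by norm_num) (fun n => ?_) fun r hr => ?_
  · have : ((8 : ℕ) : ZMod 8) = 0 := by decide
    push_cast at this ⊢
    simp only [this, add_zero]
  · obtain ⟨z, hz, hz2, h8⟩ := zeta_eight
    have z4 : z ^ 4 = -1 := by linear_combination (z ^ 2 + I) * hz2 + I_sq
    have hI8 : I * (Real.sqrt 8 : ℂ) = 2 * (z + z ^ 3) := by
      rw [h8, ← hz2]; linear_combination (-2 * z) * z4
    rw [hz, hI8]
    have z5 : z ^ 5 = -z := by linear_combination z * z4
    have z6 : z ^ 6 = -z ^ 2 := by linear_combination z ^ 2 * z4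
    have z7 : z ^ 7 = -z ^ 3 := by linear_combination z ^ 3 * z4
    have c0 : ZMod.χ₈' 0 = 0 := by decide
    have c1 : ZMod.χ₈' 1 = 1 := by decide
    have c2 : ZMod.χ₈' 2 = 0 := by decide
    have c3 : ZMod.χ₈' 3 = 1 := by decide
    have c4 : ZMod.χ₈' 4 = 0 := by decide
    have c5 : ZMod.χ₈' 5 = -1 := by decide
    have c6 : ZMod.χ₈' 6 = 0 := by decide
    have c7 : ZMod.χ₈' 7 = -1 := by decide
    interval_cases r <;>
      simp [sum_range_succ, c0, c1, c2, c3, c4, c5, c6, c7, z4, z5, z6, z7] <;> ring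

end FundamentalDiscriminant

/-! ### The Kronecker symbol of a negative fundamental discriminant -/

section Kronecker

open Complex Finset

theorem kroneckerSym_two_pow_mul (a : ℤ) (v : ℕ) {u : ℕ} (hu : Odd u) :
    kroneckerSym a ((2 ^ v * u : ℕ) : ℤ) = ZMod.χ₈ (a : ZMod 8) ^ v * jacobiSym a u := by
  have hv : padicValNat 2 (2 ^ v * u) = v := by
    rw [padicValNat.mul (by positivity) hu.pos.ne', padicValNat.prime_pow,
      padicValNat.eq_zero_of_not_dvd (by simpa [← even_iff_two_dvd] using hu), add_zero]
  have h0 : ((2 ^ v * u : ℕ) : ℤ) ≠ 0 := by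
    exact_mod_cast (Nat.mul_pos (by positivity) hu.pos).ne'
  rw [kroneckerSym, if_neg h0, if_neg (by rintro ⟨h, -⟩; omega), Int.natAbs_natCast, hv,
    Nat.mul_div_cancel_left _ (by positivity), one_mul]

theorem jacobiSym_neg_left_of_mod_four_eq_one {m : ℕ} (hm : m % 4 = 1) (n : ℤ) :
    jacobiSym (-n) m = jacobiSym n m := by
  rw [jacobiSym.neg _ (Nat.odd_iff.2 (by omega)), ZMod.χ₄_nat_one_mod_four hm, one_mul]

theorem jacobiSym_neg_left_of_mod_four_eq_three {m : ℕ} (hm : m % 4 = 3) (n : ℤ) :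
    jacobiSym (-n) m = -jacobiSym n m := by
  rw [jacobiSym.neg _ (Nat.odd_iff.2 (by omega)), ZMod.χ₄_nat_three_mod_four hm, neg_one_mul]

theorem χ₈_neg (x : ZMod 8) : ZMod.χ₈ (-x) = ZMod.χ₈ x := by revert x; decide
theorem χ₈'_neg (x : ZMod 8) : ZMod.χ₈' (-x) = -ZMod.χ₈' x := by revert x; decide
theorem χ₄_neg (x : ZMod 4) : ZMod.χ₄ (-x) = -ZMod.χ₄ x := by revert x; decide
theorem χ₈_two_mul (x : ZMod 8) : ZMod.χ₈ (2 * x) = 0 := by revert x; decide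
theorem χ₈'_two_mul (x : ZMod 8) : ZMod.χ₈' (2 * x) = 0 := by revert x; decide
theorem χ₄_two_mul (x : ZMod 4) : ZMod.χ₄ (2 * x) = 0 := by revert x; decide

/-- Reciprocity on the odd part of `n`; at 2 both symbols equal `χ₈ D`, as `χ₈` is even. -/
theorem kroneckerSym_neg_of_mod_four_eq_three {D : ℕ} (hD : D % 4 = 3) {n : ℕ} (hn : 0 < n) :
    kroneckerSym (-(D : ℤ)) n = jacobiSym n D := by
  obtain ⟨v, u, hu, rfl⟩ := Nat.exists_eq_two_pow_mul_odd hn.ne'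
  have hoD : Odd D := Nat.odd_iff.2 (by omega)
  rw [kroneckerSym_two_pow_mul _ _ hu]
  push_cast
  rw [χ₈_neg, jacobiSym.mul_left, jacobiSym.pow_left, jacobiSym.at_two hoD]
  congr 1
  rcases Nat.odd_mod_four_iff.1 (Nat.odd_iff.1 hu) with h | h
  · rw [jacobiSym_neg_left_of_mod_four_eq_one h, jacobiSym.quadratic_reciprocity_one_mod_four' hoD h]
  · rw [jacobiSym_neg_left_of_mod_four_eq_three h,
      jacobiSym.quadratic_reciprocity_three_mod_four hD h, neg_neg]

/-- For an even discriminant the Kronecker symbol is determined by its values at odd numbers. -/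
theorem kroneckerSym_eq_of_even {a : ℤ} (ha : 2 ∣ a) {ψ : ℤ → ℤ} (h2 : ∀ x, ψ (2 * x) = 0)
    (h : ∀ u : ℕ, Odd u → jacobiSym a u = ψ u) {n : ℕ} (hn : 0 < n) : kroneckerSym a n = ψ n := by
  obtain ⟨v, u, hu, rfl⟩ := Nat.exists_eq_two_pow_mul_odd hn.ne'
  rw [kroneckerSym_two_pow_mul _ _ hu]
  cases v with
  | zero => rw [pow_zero, one_mul, h u hu, pow_zero, one_mul]
  | succ v =>
    obtain ⟨b, rfl⟩ := ha
    have : (((2 ^ (v + 1) * u : ℕ)) : ℤ) = 2 * (2 ^ v * u : ℤ) := by push_cast; ring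
    rw [this, h2, pow_succ]
    push_cast
    rw [χ₈_two_mul]; ring

theorem jacobiSym_neg_four_mul {m : ℕ} (hm : m % 4 = 1) {u : ℕ} (hu : Odd u) :
    jacobiSym (-(4 * m : ℕ)) u = ZMod.χ₄ (u : ZMod 4) * jacobiSym u m := by
  rw [jacobiSym.neg _ hu]
  push_cast
  rw [jacobiSym.mul_left, jacobiSym.at_four hu, one_mul,
    jacobiSym.quadratic_reciprocity_one_mod_four hm hu]

theorem jacobiSym_neg_eight_mul (m : ℕ) {u : ℕ} (hu : Odd u) :
    jacobiSym (-(8 * m : ℕ)) u = ZMod.χ₈' (u : ZMod 8) * jacobiSym m u := by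
  have : (-(8 * m : ℕ) : ℤ) = -2 * (4 * m) := by push_cast; ring
  rw [this, jacobiSym.mul_left, jacobiSym.mul_left, jacobiSym.at_four hu, one_mul,
    jacobiSym.at_neg_two hu]

theorem jacobiSym_eight {u : ℕ} (hu : Odd u) : jacobiSym 8 u = ZMod.χ₈ (u : ZMod 8) := by
  rw [show (8 : ℤ) = 2 * 4 by norm_num, jacobiSym.mul_left, jacobiSym.at_four hu, mul_one,
    jacobiSym.at_two hu]

theorem χ₈'_eq_χ₈_mul_χ₄ (n : ℕ) :
    ZMod.χ₈' (n : ZMod 8) = ZMod.χ₈ (n : ZMod 8) * ZMod.χ₄ (n : ZMod 4) := by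
  have h4 : (n : ZMod 4) = (ZMod.castHom (show 4 ∣ 8 by norm_num) (ZMod 4) (n : ZMod 8)) := by simp
  rw [h4]
  generalize (n : ZMod 8) = x
  revert x; decide

theorem χ₈_natCast_sq {n : ℕ} (hn : Odd n) : ZMod.χ₈ (n : ZMod 8) * ZMod.χ₈ (n : ZMod 8) = 1 := by
  rw [← jacobiSym.at_two hn, ← pow_two]
  exact jacobiSym.sq_one (by
    rw [show (2 : ℤ) = (2 : ℕ) by rfl, Int.gcd_natCast_natCast]
    exact (Nat.coprime_two_left).2 hn)

/-- The Kronecker symbol of a negative fundamental discriminant `-D` is the restriction to positive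
integers of an odd eigenfunction of the finite Fourier transform, with Gauss sum `i √D`. -/
theorem exists_isFourierEigen_chiD {D : ℕ} (hmod : (-(D : ℤ)) % 4 = 0 ∨ (-(D : ℤ)) % 4 = 1)
    (hfund : ∀ f d : ℤ, -(D : ℤ) = f ^ 2 * d → (d % 4 = 0 ∨ d % 4 = 1) → f ^ 2 = 1) :
    ∃ ψ : ℤ → ℂ, IsFourierEigen D ψ (I * Real.sqrt D) ∧ (∀ n, ψ (-n) = -ψ n) ∧
      ∀ n : ℕ, 0 < n → chiD D n = ψ n := by
  -- A square `x²` dividing `m` could be removed from the discriminant, the quotient `c e` still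
  -- being 0 modulo 4.
  have hsqf : ∀ (c : ℤ) (m : ℕ), (c % 4 = 0) → -(D : ℤ) = c * m → Squarefree m := by
    rintro c m hc h x ⟨e, rfl⟩
    have := hfund x (c * e) (by rw [h]; push_cast; ring) (Or.inl (by
      rw [Int.mul_emod, hc]; simp))
    have h1 : x ^ 2 = 1 := by exact_mod_cast this
    exact Nat.isUnit_iff.2 (by nlinarith)
  by_cases hodd : D % 2 = 1
  · have hD3 : D % 4 = 3 := by omega
    have hsq : Squarefree D := by
      rintro x ⟨e, he⟩
      have hx : x % 2 = 1 := by
        rcases Nat.mod_two_eq_zero_or_one x with h | h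
        · rw [he, Nat.mul_mod, Nat.mul_mod x x, h] at hodd; simp at hodd
        · exact h
      obtain ⟨k, rfl⟩ : ∃ k, x = 2 * k + 1 := ⟨x / 2, by omega⟩
      -- Odd squares are 1 modulo 4, so `-e` has the residue of `-D`, namely 1.
      have he' : D = e + 4 * ((k ^ 2 + k) * e) := by rw [he]; ring
      have := hfund (2 * k + 1 : ℕ) (-e) (by rw [he]; push_cast; ring) (Or.inr (by omega))
      have h1 : (2 * k + 1) ^ 2 = 1 := by exact_mod_cast this
      exact Nat.isUnit_iff.2 (by nlinarith)
    refine ⟨fun n => (jacobiSym n D : ℂ), ?_, fun n => ?_, fun n hn => ?_⟩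
    · have := isFourierEigen_jacobiSym (Nat.odd_iff.2 hodd) hsq
      rwa [gaussSign, if_neg (by omega)] at this
    · simp only
      rw [jacobiSym_neg_left_of_mod_four_eq_three hD3]; push_cast; rfl
    · rw [chiD, kroneckerSym_neg_of_mod_four_eq_three hD3 hn]
  · obtain ⟨m, rfl⟩ : ∃ m, D = 4 * m := ⟨D / 4, by omega⟩
    -- In the other classes `-m` is 0 or 1 modulo 4, so `f = 2` would contradict `hfund`.
    have hm : m % 4 = 1 ∨ m % 4 = 2 := by
      by_contra hcon
      have := hfund 2 (-m) (by push_cast; ring) (by omega)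
      norm_num at this
    rcases hm with hm | hm
    · have hom : Odd m := Nat.odd_iff.2 (by omega)
      have hsq : Squarefree m := hsqf (-4) m (by norm_num) (by push_cast; ring)
      refine ⟨fun n => (ZMod.χ₄ (n : ZMod 4) : ℂ) * (jacobiSym n m : ℂ), ?_, fun n => ?_,
        fun n hn => ?_⟩
      · have h := isFourierEigen_χ₄.mul (by norm_num) hom.pos
          (show Nat.Coprime 4 m from (Nat.coprime_pow_left_iff (n := 2) two_pos 2 m).2
            (Nat.coprime_two_left.2 hom))
          (isFourierEigen_jacobiSym hom hsq)
          (fun x y => by push_cast; rw [map_mul]; push_cast; rfl)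
          (fun x y => by rw [jacobiSym.mul_left]; push_cast; rfl)
        convert h using 1
        have h1 : jacobiSym ((4 : ℕ) : ℤ) m = 1 := jacobiSym.at_four hom
        have h2 : ZMod.χ₄ (((m : ℕ) : ℤ) : ZMod 4) = 1 := by
          rw [Int.cast_natCast]; exact ZMod.χ₄_nat_one_mod_four hm
        simp only [h1, h2]
        rw [gaussSign, if_pos hm, Nat.cast_mul, Real.sqrt_mul (by positivity)]
        have h4 : Real.sqrt ((4 : ℕ) : ℝ) = 2 := by
          rw [show ((4 : ℕ) : ℝ) = 2 ^ 2 by norm_num, Real.sqrt_sq (by norm_num)]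
        rw [h4]; push_cast; ring
      · simp only
        rw [jacobiSym_neg_left_of_mod_four_eq_one hm]; push_cast; rw [χ₄_neg]; push_cast; ring
      · rw [chiD, kroneckerSym_eq_of_even (ψ := fun n => ZMod.χ₄ (n : ZMod 4) * jacobiSym n m)
          (by push_cast; exact ⟨-(2 * m), by ring⟩) (fun x => by push_cast; rw [χ₄_two_mul, zero_mul])
          (fun u hu => by rw [jacobiSym_neg_four_mul hm hu, Int.cast_natCast]) hn]
        push_cast; rfl
    · obtain ⟨k, rfl⟩ : ∃ k, m = 2 * k := ⟨m / 2, by omega⟩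
      have hok : Odd k := Nat.odd_iff.2 (by omega)
      have hsq : Squarefree k := hsqf (-8) k (by norm_num) (by push_cast; ring)
      have hD8 : 4 * (2 * k) = 8 * k := by ring
      have hc : Nat.Coprime 8 k := (Nat.coprime_pow_left_iff (n := 3) (by norm_num) 2 k).2
        (Nat.coprime_two_left.2 hok)
      have h8 : jacobiSym ((8 : ℕ) : ℤ) k = ZMod.χ₈ (k : ZMod 8) := jacobiSym_eight hok
      have h88 : (ZMod.χ₈ (k : ZMod 8) : ℂ) * ZMod.χ₈ (k : ZMod 8) = 1 := by
        exact_mod_cast χ₈_natCast_sq hok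
      rw [hD8]
      -- The symbol `(·/k)` is even for `k ≡ 1` and odd for `k ≡ 3` modulo 4; pairing it with the
      -- odd `χ₈'` or the even `χ₈` makes the product odd.
      rcases Nat.odd_mod_four_iff.1 (Nat.odd_iff.1 hok) with hk | hk
      · refine ⟨fun n => (ZMod.χ₈' (n : ZMod 8) : ℂ) * (jacobiSym n k : ℂ), ?_, fun n => ?_,
          fun n hn => ?_⟩
        · have h := isFourierEigen_χ₈'.mul (by norm_num) hok.pos hc
            (isFourierEigen_jacobiSym hok hsq)
            (fun x y => by push_cast; rw [map_mul]; push_cast; rfl)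
            (fun x y => by rw [jacobiSym.mul_left]; push_cast; rfl)
          convert h using 1
          have h2 : ZMod.χ₈' (((k : ℕ) : ℤ) : ZMod 8) = ZMod.χ₈ (k : ZMod 8) := by
            rw [Int.cast_natCast, χ₈'_eq_χ₈_mul_χ₄, ZMod.χ₄_nat_one_mod_four hk, mul_one]
          simp only [h8, h2]
          rw [gaussSign, if_pos hk, Nat.cast_mul, Real.sqrt_mul (by positivity), h88]
          push_cast; ring
        · simp only
          rw [jacobiSym_neg_left_of_mod_four_eq_one hk]; push_cast; rw [χ₈'_neg]; push_cast; ring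
        · rw [chiD, kroneckerSym_eq_of_even (ψ := fun n => ZMod.χ₈' (n : ZMod 8) * jacobiSym n k)
            (by push_cast; exact ⟨-(4 * k), by ring⟩)
            (fun x => by push_cast; rw [χ₈'_two_mul, zero_mul])
            (fun u hu => by rw [jacobiSym_neg_eight_mul k hu, Int.cast_natCast,
              jacobiSym.quadratic_reciprocity_one_mod_four hk hu]) hn]
          push_cast; rfl
      · refine ⟨fun n => (ZMod.χ₈ (n : ZMod 8) : ℂ) * (jacobiSym n k : ℂ), ?_, fun n => ?_,
          fun n hn => ?_⟩
        · have h := isFourierEigen_χ₈.mul (by norm_num) hok.pos hc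
            (isFourierEigen_jacobiSym hok hsq)
            (fun x y => by push_cast; rw [map_mul]; push_cast; rfl)
            (fun x y => by rw [jacobiSym.mul_left]; push_cast; rfl)
          convert h using 1
          simp only [h8, Int.cast_natCast]
          rw [gaussSign, if_neg (by omega), Nat.cast_mul, Real.sqrt_mul (by positivity), h88]
          push_cast; ring
        · simp only
          rw [jacobiSym_neg_left_of_mod_four_eq_three hk]; push_cast; rw [χ₈_neg]; ring
        · rw [chiD, kroneckerSym_eq_of_even (ψ := fun n => ZMod.χ₈ (n : ZMod 8) * jacobiSym n k)
            (by push_cast; exact ⟨-(4 * k), by ring⟩)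
            (fun x => by push_cast; rw [χ₈_two_mul, zero_mul])
            (fun u hu => by
              rw [jacobiSym_neg_eight_mul k hu, Int.cast_natCast, χ₈'_eq_χ₈_mul_χ₄]
              rcases Nat.odd_mod_four_iff.1 (Nat.odd_iff.1 hu) with h | h
              · rw [ZMod.χ₄_nat_one_mod_four h, mul_one,
                  jacobiSym.quadratic_reciprocity_one_mod_four' hok h]
              · rw [ZMod.χ₄_nat_three_mod_four h,
                  jacobiSym.quadratic_reciprocity_three_mod_four hk h]; ring) hn]
          push_cast; rfl

end Kronecker

/-! ### A derivation-stable space of rapidly decaying exponential quotients -/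

section SchwartzSpan

open Finset

/-- A family of rapidly decaying differentiable functions whose span is closed under derivation
spans a space of Schwartz functions. -/
theorem exists_schwartzMap_of_mem_span {A : Set (ℝ → ℂ)} (hdiff : ∀ f ∈ A, Differentiable ℝ f)
    (hderiv : ∀ f ∈ A, deriv f ∈ Submodule.span ℂ A)
    (hdecay : ∀ f ∈ A, ∀ k : ℕ, ∃ C : ℝ, ∀ x, |x| ^ k * ‖f x‖ ≤ C) {f : ℝ → ℂ}
    (hf : f ∈ Submodule.span ℂ A) : ∃ g : 𝓢(ℝ, ℂ), ∀ x, g x = f x := by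
  have key : ∀ f ∈ Submodule.span ℂ A, Differentiable ℝ f ∧ deriv f ∈ Submodule.span ℂ A ∧
      ∀ k : ℕ, ∃ C : ℝ, ∀ x, |x| ^ k * ‖f x‖ ≤ C := by
    intro f hf
    induction hf using Submodule.span_induction with
    | mem f hf => exact ⟨hdiff f hf, hderiv f hf, hdecay f hf⟩
    | zero =>
      refine ⟨differentiable_const 0, ?_, fun k => ⟨0, fun x => by simp⟩⟩
      have : deriv (0 : ℝ → ℂ) = 0 := by ext x; simp
      rw [this]; exact Submodule.zero_mem _
    | add f g _ _ hf hg =>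
      refine ⟨hf.1.add hg.1, ?_, fun k => ?_⟩
      · have : deriv (f + g) = deriv f + deriv g := by
          ext x; exact deriv_add (hf.1 x) (hg.1 x)
        rw [this]; exact Submodule.add_mem _ hf.2.1 hg.2.1
      · obtain ⟨C, hC⟩ := hf.2.2 k
        obtain ⟨C', hC'⟩ := hg.2.2 k
        refine ⟨C + C', fun x => ?_⟩
        calc |x| ^ k * ‖(f + g) x‖ ≤ |x| ^ k * (‖f x‖ + ‖g x‖) := by
              gcongr; exact norm_add_le _ _
          _ ≤ C + C' := by rw [mul_add]; exact add_le_add (hC x) (hC' x)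
    | smul a f _ hf =>
      refine ⟨hf.1.const_smul a, ?_, fun k => ?_⟩
      · have : deriv (a • f) = a • deriv f := by
          ext x; exact deriv_const_smul a (hf.1 x)
        rw [this]; exact Submodule.smul_mem _ _ hf.2.1
      · obtain ⟨C, hC⟩ := hf.2.2 k
        refine ⟨‖a‖ * C, fun x => ?_⟩
        rw [Pi.smul_apply, norm_smul, mul_left_comm]
        gcongr
        exact hC x
  have hiter : ∀ n : ℕ, iteratedDeriv n f ∈ Submodule.span ℂ A := by
    intro n
    induction n with
    | zero => rwa [iteratedDeriv_zero]
    | succ n ih => rw [iteratedDeriv_succ]; exact (key _ ih).2.1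
  refine ⟨⟨f, ?_, fun k n => ?_⟩, fun x => rfl⟩
  · exact contDiff_of_differentiable_iteratedDeriv fun m _ => (key _ (hiter m)).1
  · obtain ⟨C, hC⟩ := (key _ (hiter n)).2.2 k
    refine ⟨C, fun x => ?_⟩
    rw [norm_iteratedFDeriv_eq_norm_iteratedDeriv, Real.norm_eq_abs]
    exact hC x

/-- The exponential quotient `e ^ (j c x) / (∑_{i < D} e ^ (i c x)) ^ m`. -/
noncomputable def expQuot (c : ℝ) (D j m : ℕ) (x : ℝ) : ℝ :=
  Real.exp (j * (c * x)) / (∑ i ∈ range D, Real.exp (i * (c * x))) ^ m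

theorem sum_exp_pos {D : ℕ} (hD : 0 < D) (y : ℝ) : 0 < ∑ i ∈ range D, Real.exp (i * y) :=
  sum_pos (fun _ _ => Real.exp_pos _) ⟨0, mem_range.2 hD⟩

/-- By the quotient rule, differentiating the denominator adds one power of the sum below and one of
its exponentials above, so the derivative stays in the span of the family. -/
theorem hasDerivAt_expQuot (c : ℝ) {D : ℕ} (hD : 0 < D) (j m : ℕ) (x : ℝ) :
    HasDerivAt (expQuot c D j m)
      (j * c * expQuot c D j m x - m * ∑ i ∈ range D, i * c * expQuot c D (j + i) (m + 1) x) x := by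
  have hexp : ∀ i : ℕ, HasDerivAt (fun x : ℝ => Real.exp (i * (c * x)))
      (Real.exp (i * (c * x)) * (i * c)) x := fun i => by
    have h : HasDerivAt (fun x : ℝ => (i : ℝ) * (c * x)) (i * c) x := by
      simpa using ((hasDerivAt_id x).const_mul c).const_mul (i : ℝ)
    exact h.exp
  have hS := (HasDerivAt.fun_sum (u := range D) fun i _ => hexp i)
  have hpos := sum_exp_pos hD (c * x)
  have h := (hexp j).div (hS.pow m) (pow_pos hpos m).ne'
  refine h.congr_deriv ?_
  rw [Pi.pow_apply]
  have hterm : ∀ i ∈ range D, (i : ℝ) * c * expQuot c D (j + i) (m + 1) x =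
      Real.exp (i * (c * x)) * (i * c) * (Real.exp (j * (c * x)) /
        (∑ i ∈ range D, Real.exp (i * (c * x))) ^ (m + 1)) := by
    intro i _
    rw [expQuot, Nat.cast_add, add_mul, Real.exp_add]; ring
  rw [sum_congr rfl hterm, ← sum_mul, expQuot]
  generalize (∑ i ∈ range D, Real.exp (i * (c * x)) * (i * c)) = T
  generalize (∑ i ∈ range D, Real.exp (i * (c * x))) = S at hpos
  cases m with
  | zero => simp; ring
  | succ m =>
    simp only [Nat.add_sub_cancel]
    field_simp
    push_cast
    ring

/-- For `x ≥ 0` the sum is at least its top term, giving exponent `j - m (D - 1) ≤ -1`; for `x ≤ 0`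
it is at least its constant term, leaving exponent `j ≥ 1`. -/
theorem expQuot_le {c : ℝ} (hc : 0 < c) {D j m : ℕ} (hD : 0 < D) (hj : 0 < j) (hjm : j + m < m * D)
    (x : ℝ) : expQuot c D j m x ≤ Real.exp (-(c * |x|)) := by
  have hpos := sum_exp_pos hD (c * x)
  rw [expQuot, div_le_iff₀ (pow_pos hpos m)]
  have hj1 : (1 : ℝ) ≤ j := by exact_mod_cast hj
  rcases le_total 0 x with hx | hx
  · have hcx : 0 ≤ c * x := by positivity
    have hS : Real.exp ((D - 1 : ℕ) * (c * x)) ≤ ∑ i ∈ range D, Real.exp (i * (c * x)) :=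
      single_le_sum (f := fun i : ℕ => Real.exp (i * (c * x))) (fun _ _ => (Real.exp_pos _).le)
        (mem_range.2 (by omega))
    calc Real.exp (j * (c * x)) ≤ Real.exp (-(c * |x|)) * Real.exp ((D - 1 : ℕ) * (c * x)) ^ m := by
          rw [← Real.exp_nat_mul, ← Real.exp_add, Real.exp_le_exp, abs_of_nonneg hx]
          have h1 : (j : ℝ) + 1 ≤ m * (D - 1 : ℕ) := by
            have : j + 1 ≤ m * (D - 1) := by rw [Nat.mul_sub, mul_one]; omega
            exact_mod_cast this
          nlinarith
      _ ≤ _ := by gcongr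
  · have hcx : c * x ≤ 0 := mul_nonpos_of_nonneg_of_nonpos hc.le hx
    have hS : 1 ≤ ∑ i ∈ range D, Real.exp (i * (c * x)) := by
      have := single_le_sum (f := fun i : ℕ => Real.exp (i * (c * x)))
        (fun _ _ => (Real.exp_pos _).le) (mem_range.2 hD)
      simpa using this
    calc Real.exp (j * (c * x)) ≤ Real.exp (-(c * |x|)) * 1 := by
          rw [mul_one, Real.exp_le_exp, abs_of_nonpos hx]
          nlinarith
      _ ≤ _ := by gcongr; exact one_le_pow₀ hS

theorem pow_mul_exp_neg_le {c : ℝ} (hc : 0 < c) (k : ℕ) (x : ℝ) :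
    |x| ^ k * Real.exp (-(c * |x|)) ≤ k.factorial / c ^ k := by
  have h := Real.pow_div_factorial_le_exp (c * |x|) (by positivity) k
  rw [Real.exp_neg, ← div_eq_mul_inv, div_le_div_iff₀ (Real.exp_pos _) (by positivity)]
  rw [div_le_iff₀ (by positivity), mul_pow] at h
  linarith

/-- The constraints `0 < j` and `j + m < m * D` ensure decay at both ends and survive `(j, m) ↦ (j +
i, m + 1)`, because `i + 1 ≤ D`. -/
theorem exists_schwartzMap_of_mem_span_expQuot {c : ℝ} (hc : 0 < c) {D : ℕ} (hD : 0 < D)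
    {f : ℝ → ℂ}
    (hf : f ∈ Submodule.span ℂ {f : ℝ → ℂ | ∃ j m : ℕ, 0 < j ∧ j + m < m * D ∧
      f = fun x => (expQuot c D j m x : ℂ)}) : ∃ g : 𝓢(ℝ, ℂ), ∀ x, g x = f x := by
  have hd : ∀ j m x, HasDerivAt (fun x => (expQuot c D j m x : ℂ)) _ x :=
    fun j m x => (hasDerivAt_expQuot c hD j m x).ofReal_comp
  refine exists_schwartzMap_of_mem_span ?_ ?_ ?_ hf
  · rintro _ ⟨j, m, -, -, rfl⟩ x
    exact (hd j m x).differentiableAt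
  · rintro _ ⟨j, m, hj, hjm, rfl⟩
    have : deriv (fun x => (expQuot c D j m x : ℂ)) =
        ((j * c : ℝ) : ℂ) • (fun x => (expQuot c D j m x : ℂ)) - (m : ℂ) • ∑ i ∈ range D,
          ((i * c : ℝ) : ℂ) • (fun x => (expQuot c D (j + i) (m + 1) x : ℂ)) := by
      ext x
      rw [(hd j m x).deriv]
      simp only [Pi.sub_apply, Pi.smul_apply, Finset.sum_apply, smul_eq_mul]
      push_cast; rfl
    rw [this]
    refine Submodule.sub_mem _ (Submodule.smul_mem _ _ (Submodule.subset_span ⟨j, m, hj, hjm, rfl⟩))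
      (Submodule.smul_mem _ _ (Submodule.sum_mem _ fun i hi => Submodule.smul_mem _ _
        (Submodule.subset_span ⟨j + i, m + 1, by omega, ?_, rfl⟩)))
    have := mem_range.1 hi
    rw [add_mul, one_mul]; omega
  · rintro _ ⟨j, m, hj, hjm, rfl⟩ k
    refine ⟨_, fun x => le_trans ?_ (pow_mul_exp_neg_le hc k x)⟩
    gcongr
    rw [Complex.norm_real, Real.norm_of_nonneg (show 0 ≤ expQuot c D j m x from
      div_nonneg (Real.exp_pos _).le (pow_nonneg (sum_exp_pos hD _).le _))]
    exact expQuot_le hc hD hj hjm x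

end SchwartzSpan

/-! ### Removing the singularity at 1, and the Schwartz property -/

section TwistedQuotient

open Finset Filter

variable {D : ℕ} {ψ : ℤ → ℂ}

/-- Each `t ^ n` is `t - (1 - t)(t + ⋯ + t ^ (n - 1))`, and the terms `ψ n * t` cancel in the sum.
-/
theorem sum_mul_pow_eq (hsum : ∑ n ∈ Ico 1 D, ψ n = 0) (t : ℂ) :
    ∑ n ∈ Ico 1 D, ψ n * t ^ n =
      -((1 - t) * ∑ n ∈ Ico 1 D, ψ n * ∑ i ∈ range (n - 1), t ^ (i + 1)) := by
  have h : ∀ n ∈ Ico 1 D, ψ n * t ^ n =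
      ψ n * t - (1 - t) * (ψ n * ∑ i ∈ range (n - 1), t ^ (i + 1)) := by
    intro n hn
    obtain ⟨k, rfl⟩ : ∃ k, n = k + 1 := ⟨n - 1, by have := (mem_Ico.1 hn).1; omega⟩
    have hg := mul_neg_geom_sum t k
    simp only [Nat.add_sub_cancel, pow_succ, ← sum_mul]
    linear_combination (ψ (k + 1 : ℕ) * t) * hg
  rw [sum_congr rfl h, sum_sub_distrib, ← sum_mul, hsum, ← mul_sum]
  ring

theorem twistedQuotient_eq (hsum : ∑ n ∈ Ico 1 D, ψ n = 0) {t : ℂ} (ht : t ≠ 1) :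
    twistedQuotient D ψ t =
      -(∑ n ∈ Ico 1 D, ψ n * ∑ i ∈ range (n - 1), t ^ (i + 1)) / ∑ i ∈ range D, t ^ i := by
  have h1 : 1 - t ≠ 0 := sub_ne_zero.2 ht.symm
  rw [twistedQuotient, sum_mul_pow_eq hsum, ← mul_neg_geom_sum, neg_mul_eq_mul_neg,
    mul_div_mul_left _ _ h1]

/-- The form with `1 - t` cancelled has denominator `D ≠ 0` at `t = 1`, hence is continuous there
and supplies the limit. -/
theorem phiTwisted_eq (hD : 0 < D) (hsum : ∑ n ∈ Ico 1 D, ψ n = 0) (t : ℂ) :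
    phiTwisted D ψ t =
      -(∑ n ∈ Ico 1 D, ψ n * ∑ i ∈ range (n - 1), t ^ (i + 1)) / ∑ i ∈ range D, t ^ i := by
  rw [phiTwisted]
  split_ifs with ht
  · subst ht
    refine Tendsto.limUnder_eq ?_
    have hcont : ContinuousAt (fun t : ℂ => -(∑ n ∈ Ico 1 D, ψ n * ∑ i ∈ range (n - 1), t ^ (i + 1)) /
        ∑ i ∈ range D, t ^ i) 1 := by
      refine ContinuousAt.div (by fun_prop) (by fun_prop) ?_
      simpa using hD.ne'
    refine (hcont.tendsto.mono_left nhdsWithin_le_nhds).congr' ?_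
    filter_upwards [self_mem_nhdsWithin] with t ht
    exact (twistedQuotient_eq hsum ht).symm
  · exact twistedQuotient_eq hsum ht

theorem exists_schwartzMap_PhiTwisted (hD : 0 < D) (hsum : ∑ n ∈ Ico 1 D, ψ n = 0) :
    ∃ f : 𝓢(ℝ, ℂ), ∀ x : ℝ, f x = PhiTwisted D ψ x := by
  have hDR : (0 : ℝ) < D := by exact_mod_cast hD
  set c : ℝ := 2 * Real.pi / Real.sqrt D with hc
  have hcpos : 0 < c := by have := Real.sqrt_pos.2 hDR; positivity
  refine exists_schwartzMap_of_mem_span_expQuot hcpos hD ?_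
  have hΦ : PhiTwisted D ψ = -∑ n ∈ Ico 1 D, ψ n • ∑ i ∈ range (n - 1),
      (fun x => (expQuot c D (i + 1) 1 x : ℂ)) := by
    ext x
    rw [PhiTwisted, phiTwisted_eq hD hsum]
    have hx : 2 * Real.pi * x / Real.sqrt D = c * x := by rw [hc]; ring
    rw [hx]
    simp only [expQuot, Pi.neg_apply, Finset.sum_apply, Pi.smul_apply, smul_eq_mul, pow_one]
    have hpow : ∀ i : ℕ, ((Real.exp (c * x) : ℝ) : ℂ) ^ i = (Real.exp (i * (c * x)) : ℝ) := by
      intro i; rw [Real.exp_nat_mul]; push_cast; rfl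
    simp only [hpow]
    rw [neg_div, sum_div]
    congr 1
    refine sum_congr rfl fun n _ => ?_
    rw [mul_div_assoc, sum_div]
    push_cast; rfl
  rw [hΦ]
  refine Submodule.neg_mem _ (Submodule.sum_mem _ fun n hn => Submodule.smul_mem _ _
    (Submodule.sum_mem _ fun i hi => Submodule.subset_span ⟨i + 1, 1, by omega, ?_, rfl⟩))
  have h1 := mem_range.1 hi
  have h2 := (mem_Ico.1 hn).2
  omega

end TwistedQuotient

/-! ### Self-duality through the cotangent expansion -/

section FourierTransform

open Finset Filter Complex MeasureTheory

variable {D : ℕ} {ψ : ℤ → ℂ}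

theorem IsFourierEigen.apply_sub {g : ℂ} (h : IsFourierEigen D ψ g)
    (hodd : ∀ n, ψ (-n) = -ψ n) {n : ℕ} (hn : n ≤ D) : ψ (D - n : ℕ) = -ψ n := by
  rw [Nat.cast_sub hn, ← hodd, ← h.1 (-n)]
  congr 1; ring

theorem apply_zero_of_odd (hodd : ∀ n, ψ (-n) = -ψ n) : ψ 0 = 0 := by
  have := hodd 0
  rw [neg_zero] at this
  exact self_eq_neg.1 this

theorem sum_range_eq_sum_Ico_of_odd (hD : 0 < D) (hodd : ∀ n, ψ (-n) = -ψ n) (F : ℕ → ℂ) :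
    ∑ a ∈ range D, ψ a * F a = ∑ a ∈ Ico 1 D, ψ a * F a := by
  rw [range_eq_Ico, sum_eq_sum_Ico_succ_bot hD]
  simp [apply_zero_of_odd hodd]

/-- The eigenvalue relation at frequency 0, where `ψ 0 = 0` by oddness. -/
theorem IsFourierEigen.sum_Ico_eq_zero {g : ℂ} (h : IsFourierEigen D ψ g) (hD : 0 < D)
    (hodd : ∀ n, ψ (-n) = -ψ n) : ∑ n ∈ Ico 1 D, ψ n = 0 := by
  have h1 := h.2 0
  have h2 := sum_range_eq_sum_Ico_of_odd hD hodd (fun _ => 1)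
  simp only [Int.cast_zero, mul_zero, zero_div, exp_zero, mul_one, apply_zero_of_odd hodd] at h1 h2
  rw [← h2, h1]

/-- Reflection `n ↦ D - n` in a sum against an odd periodic function. -/
theorem IsFourierEigen.sum_Ico_reflect {g : ℂ} (h : IsFourierEigen D ψ g)
    (hodd : ∀ n, ψ (-n) = -ψ n) (F : ℕ → ℂ) :
    ∑ n ∈ Ico 1 D, ψ n * F n = -∑ n ∈ Ico 1 D, ψ n * F (D - n) := by
  rw [← sum_neg_distrib]
  refine sum_nbij' (fun n => D - n) (fun n => D - n) ?_ ?_ ?_ ?_ ?_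
  · intro n hn; rw [mem_Ico] at hn ⊢; omega
  · intro n hn; rw [mem_Ico] at hn ⊢; omega
  · intro n hn; rw [mem_Ico] at hn; omega
  · intro n hn; rw [mem_Ico] at hn; omega
  · intro n hn
    rw [mem_Ico] at hn
    rw [h.apply_sub hodd (by omega), show D - (D - n) = n by omega]
    ring

theorem PhiTwisted_of_ne_zero (hD : 0 < D) {x : ℝ} (hx : x ≠ 0) : PhiTwisted D ψ x =
    twistedQuotient D ψ (Real.exp (2 * Real.pi * x / Real.sqrt D) : ℝ) := by
  have hDR : (0 : ℝ) < D := by exact_mod_cast hD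
  rw [PhiTwisted, phiTwisted, if_neg]
  have h1 : 2 * Real.pi * x / Real.sqrt D ≠ 0 := by
    have := Real.sqrt_pos.2 hDR
    have := Real.pi_pos
    positivity
  rw [ofReal_eq_one, Real.exp_eq_one_iff]
  exact h1

/-- Under `t ↦ t⁻¹`, with `n ↦ D - n` in the sum, numerator and denominator both acquire the factor
`-(t ^ D)⁻¹`. -/
theorem IsFourierEigen.PhiTwisted_neg {g : ℂ} (h : IsFourierEigen D ψ g) (hD : 0 < D)
    (hodd : ∀ n, ψ (-n) = -ψ n) (x : ℝ) : PhiTwisted D ψ (-x) = PhiTwisted D ψ x := by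
  rcases eq_or_ne x 0 with rfl | hx
  · rw [neg_zero]
  rw [PhiTwisted_of_ne_zero hD hx, PhiTwisted_of_ne_zero hD (neg_ne_zero.2 hx)]
  have hexp : 2 * Real.pi * -x / Real.sqrt D = -(2 * Real.pi * x / Real.sqrt D) := by ring
  rw [hexp, Real.exp_neg, ofReal_inv]
  have ht : ((Real.exp (2 * Real.pi * x / Real.sqrt D) : ℝ) : ℂ) ≠ 0 := by
    exact_mod_cast (Real.exp_pos _).ne'
  generalize ((Real.exp (2 * Real.pi * x / Real.sqrt D) : ℝ) : ℂ) = t at ht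
  rw [twistedQuotient, twistedQuotient, h.sum_Ico_reflect hodd (fun n => t⁻¹ ^ n)]
  have hterm : ∀ n ∈ Ico 1 D, ψ n * t⁻¹ ^ (D - n) = (t ^ D)⁻¹ * (ψ n * t ^ n) := by
    intro n hn
    rw [mem_Ico] at hn
    have : t ^ D = t ^ (D - n) * t ^ n := by rw [← pow_add]; congr 1; omega
    rw [this, inv_pow]; field_simp
  rw [sum_congr rfl hterm, ← mul_sum]
  have htD : t ^ D ≠ 0 := pow_ne_zero _ ht
  have hden : 1 - t⁻¹ ^ D = -((t ^ D)⁻¹ * (1 - t ^ D)) := by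
    rw [inv_pow]; field_simp; ring
  rw [hden, neg_div_neg_eq, mul_div_mul_left _ _ (inv_ne_zero htD)]

theorem sum_range_mul_eq_sum_sum (D K : ℕ) (F : ℕ → ℂ) :
    ∑ n ∈ range (D * K), F n = ∑ k ∈ range K, ∑ a ∈ range D, F (a + D * k) := by
  induction K with
  | zero => simp
  | succ K ih =>
    rw [Nat.mul_succ, sum_range_add, ih, sum_range_succ]
    simp only [add_comm]

/-- The truncated twisted geometric series. -/
theorem IsFourierEigen.sum_range_pow {g : ℂ} (h : IsFourierEigen D ψ g) (hD : 0 < D)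
    (hodd : ∀ n, ψ (-n) = -ψ n) (K : ℕ) {q : ℂ} (hq : q ^ D ≠ 1) :
    ∑ n ∈ range (D * K), ψ n * q ^ n = twistedQuotient D ψ q * (1 - (q ^ D) ^ K) := by
  rw [sum_range_mul_eq_sum_sum]
  have h1 : ∀ k ∈ range K, ∑ a ∈ range D, ψ (a + D * k : ℕ) * q ^ (a + D * k) =
      (q ^ D) ^ k * ∑ n ∈ Ico 1 D, ψ n * q ^ n := by
    intro k _
    rw [← sum_range_eq_sum_Ico_of_odd hD hodd, mul_sum]
    refine sum_congr rfl fun a _ => ?_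
    have := apply_mul_add_of_periodic h.1 k a
    push_cast
    rw [add_comm (a : ℤ), this, pow_add, pow_mul]; ring
  rw [sum_congr rfl h1, ← sum_mul, twistedQuotient, ← mul_neg_geom_sum (q ^ D) K]
  have : 1 - q ^ D ≠ 0 := sub_ne_zero.2 hq.symm
  field_simp

/-- The partial fraction expansion of the cotangent, summed in another order. -/
theorem tendsto_sum_inv_add_inv {w : ℂ} (hw : w ∈ integerComplement) :
    Tendsto (fun K : ℕ => ∑ k ∈ range K, (1 / (w + k) + 1 / (w - (k + 1)))) atTop
      (𝓝 (Real.pi * cot (Real.pi * w))) := by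
  -- This pairing differs from the symmetric partial sum by a boundary term `1 / (w + K)`, which
  -- tends to 0.
  have h1 : ∀ K : ℕ, ∑ k ∈ range K, (1 / (w + k) + 1 / (w - (k + 1))) =
      1 / w + ∑ k ∈ range K, cotTerm w k - 1 / (w + K) := by
    intro K
    induction K with
    | zero => simp
    | succ K ih =>
      rw [sum_range_succ, ih, sum_range_succ, cotTerm]
      push_cast; ring
  have h2 : Tendsto (fun K : ℕ => 1 / (w + K)) atTop (𝓝 0) := by
    simp only [one_div]
    refine tendsto_inv₀_cobounded.comp ?_
    exact (tendsto_const_add_cobounded w).comp tendsto_natCast_atTop_cobounded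
  have h3 := ((tendsto_const_nhds (x := 1 / w)).add (tendsto_logDeriv_euler_cot_sub hw)).sub h2
  simp only [h1]
  convert h3 using 2
  ring

/-- With `u = e^(2πia/D) q` one has `u ^ D = q ^ D`, so `1/(1 - u)` is `∑ u ^ j` over `1 - q ^ D`;
summing over `a` first gives the finite Fourier transform of `ψ` at `j`. -/
theorem sum_inv_one_sub_mul {g : ℂ} (h : IsFourierEigen D ψ g) (hD : 0 < D)
    (hodd : ∀ n, ψ (-n) = -ψ n) {q : ℂ} (hq : q ^ D ≠ 1) :
    ∑ a ∈ Ico 1 D, ψ a / (1 - cexp (2 * Real.pi * I * (a / D)) * q) =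
      g * twistedQuotient D ψ q := by
  have hD' : (D : ℂ) ≠ 0 := by exact_mod_cast hD.ne'
  have hq' : 1 - q ^ D ≠ 0 := sub_ne_zero.2 hq.symm
  have hterm : ∀ a : ℕ, ψ a / (1 - cexp (2 * Real.pi * I * (a / D)) * q) =
      (∑ j ∈ range D, q ^ j * (ψ a * cexp (2 * Real.pi * I * (a * (j : ℤ) / D)))) / (1 - q ^ D) := by
    intro a
    set u := cexp (2 * Real.pi * I * (a / D)) * q with hu
    have huD : u ^ D = q ^ D := by
      rw [hu, mul_pow, ← exp_nat_mul, show (D : ℂ) * (2 * Real.pi * I * (a / D)) =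
        a * (2 * Real.pi * I) by field_simp, exp_nat_mul_two_pi_mul_I, one_mul]
    have hu1 : 1 - u ≠ 0 := by
      intro h0
      rw [← huD, (sub_eq_zero.1 h0).symm, one_pow] at hq
      exact hq rfl
    have hgeom := mul_neg_geom_sum u D
    rw [huD] at hgeom
    have hsum : ∑ j ∈ range D, q ^ j * (ψ a * cexp (2 * Real.pi * I * (a * (j : ℤ) / D))) =
        ψ a * ∑ j ∈ range D, u ^ j := by
      rw [mul_sum]
      refine sum_congr rfl fun j _ => ?_
      rw [hu, mul_pow, ← exp_nat_mul, show (j : ℂ) * (2 * Real.pi * I * (a / D)) =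
        2 * Real.pi * I * (a * (j : ℤ) / D) by push_cast; ring]
      ring
    rw [hsum, div_eq_div_iff hu1 hq', ← hgeom]
    ring
  have h0 := sum_range_eq_sum_Ico_of_odd hD hodd
    (fun a => 1 / (1 - cexp (2 * Real.pi * I * (a / D)) * q))
  simp only [mul_one_div] at h0
  rw [← h0]
  simp only [hterm]
  rw [← sum_div, sum_comm]
  simp only [← mul_sum, h.2]
  rw [twistedQuotient, ← sum_range_eq_sum_Ico_of_odd hD hodd, mul_div_assoc', mul_sum]
  congr 1
  exact sum_congr rfl fun j _ => by ring

/-- With `u = e^(2πiw)`, `cot (πw) = i - 2i/(1 - u)`, and the constant `i` drops out since `ψ` sums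
to zero. -/
theorem sum_mul_cot {g : ℂ} (h : IsFourierEigen D ψ g) (hD : 0 < D)
    (hodd : ∀ n, ψ (-n) = -ψ n) {z : ℂ} (hz : cexp (2 * Real.pi * I * z) ≠ 1) :
    ∑ a ∈ Ico 1 D, ψ a * cot (Real.pi * ((a + z) / D)) =
      -2 * I * g * twistedQuotient D ψ (cexp (2 * Real.pi * I * (z / D))) := by
  have hD' : (D : ℂ) ≠ 0 := by exact_mod_cast hD.ne'
  set q := cexp (2 * Real.pi * I * (z / D)) with hqdef
  have hq : q ^ D ≠ 1 := by
    rwa [hqdef, ← exp_nat_mul, show (D : ℂ) * (2 * Real.pi * I * (z / D)) = 2 * Real.pi * I * z by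
      field_simp]
  have hterm : ∀ a : ℕ, ψ a * cot (Real.pi * ((a + z) / D)) =
      -2 * I * (ψ a / (1 - cexp (2 * Real.pi * I * (a / D)) * q)) + I * ψ a := by
    intro a
    rw [Complex.cot_pi_eq_exp_ratio, add_div (a : ℂ) z, mul_add (2 * Real.pi * I), exp_add, ← hqdef]
    have hu1 : 1 - cexp (2 * Real.pi * I * (a / D)) * q ≠ 0 := by
      intro h0
      have : (cexp (2 * Real.pi * I * (a / D)) * q) ^ D = q ^ D := by
        rw [mul_pow, ← exp_nat_mul, show (D : ℂ) * (2 * Real.pi * I * (a / D)) =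
          a * (2 * Real.pi * I) by field_simp, exp_nat_mul_two_pi_mul_I, one_mul]
      rw [← sub_eq_zero.1 h0, one_pow] at this
      exact hq this.symm
    generalize cexp (2 * Real.pi * I * (a / D)) * q = u at hu1
    have hI : (u + 1) / (I * (1 - u)) = -I * ((u + 1) / (1 - u)) := by
      field_simp
      linear_combination (u + 1) * I_sq
    rw [hI]
    field_simp
    ring
  simp only [hterm]
  rw [sum_add_distrib, ← mul_sum, ← mul_sum, h.sum_Ico_eq_zero hD hodd, mul_zero, add_zero,
    sum_inv_one_sub_mul h hD hodd hq]
  ring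

theorem integral_exp_mul_cos {a t : ℝ} (ha : 0 < a) :
    IntegrableOn (fun x : ℝ => cexp (-(a * x)) *
      (cexp (2 * Real.pi * I * t * x) + cexp (-(2 * Real.pi * I * t * x)))) (Set.Ioi 0) ∧
    ∫ x : ℝ in Set.Ioi 0, cexp (-(a * x)) *
      (cexp (2 * Real.pi * I * t * x) + cexp (-(2 * Real.pi * I * t * x))) =
      1 / (a + 2 * Real.pi * t * I) + 1 / (a - 2 * Real.pi * t * I) := by
  have h1 : (-(a : ℂ) + (2 * Real.pi * t : ℝ) * I).re < 0 := by simpa using ha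
  have h2 : (-(a : ℂ) + (-(2 * Real.pi * t) : ℝ) * I).re < 0 := by simpa using ha
  have hfun : (fun x : ℝ => cexp (-(a * x)) *
      (cexp (2 * Real.pi * I * t * x) + cexp (-(2 * Real.pi * I * t * x)))) =
      fun x : ℝ => cexp ((-(a : ℂ) + (2 * Real.pi * t : ℝ) * I) * x) +
        cexp ((-(a : ℂ) + (-(2 * Real.pi * t) : ℝ) * I) * x) := by
    ext x
    rw [mul_add, ← exp_add, ← exp_add]
    congr 2 <;> (push_cast; ring)
  rw [hfun]
  have i1 := integrableOn_exp_mul_complex_Ioi h1 0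
  have i2 := integrableOn_exp_mul_complex_Ioi h2 0
  refine ⟨i1.add i2, ?_⟩
  rw [integral_add i1 i2, integral_exp_mul_complex_Ioi h1, integral_exp_mul_complex_Ioi h2]
  have n1 : -(a : ℂ) + (2 * Real.pi * t : ℝ) * I ≠ 0 := fun h0 => by rw [h0] at h1; simp at h1
  have n2 : -(a : ℂ) + (-(2 * Real.pi * t) : ℝ) * I ≠ 0 := fun h0 => by rw [h0] at h2; simp at h2
  have e1 : (a + 2 * Real.pi * t * I : ℂ) = -(-(a : ℂ) + (-(2 * Real.pi * t) : ℝ) * I) := by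
    push_cast; ring
  have e2 : (a - 2 * Real.pi * t * I : ℂ) = -(-(a : ℂ) + (2 * Real.pi * t : ℝ) * I) := by
    push_cast; ring
  rw [e1, e2, ofReal_zero, mul_zero, mul_zero, exp_zero, div_neg, div_neg, neg_div, neg_div]
  ring

/-- Rearrangement of the partial sums of `∑ ψ n / (n ± z)` into cotangent series. -/
theorem IsFourierEigen.sum_range_inv {g : ℂ} (h : IsFourierEigen D ψ g) (hD : 0 < D)
    (hodd : ∀ n, ψ (-n) = -ψ n) (K : ℕ) (z : ℂ) :
    ∑ n ∈ range (D * K), ψ n * (1 / (n + z) + 1 / (n - z)) =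
      1 / D * ∑ a ∈ Ico 1 D, ψ a *
        ∑ k ∈ range K, (1 / ((a + z) / D + k) + 1 / ((a + z) / D - (k + 1))) := by
  have hD' : (D : ℂ) ≠ 0 := by exact_mod_cast hD.ne'
  rw [sum_range_mul_eq_sum_sum]
  simp only [mul_sum]
  rw [sum_comm (s := Ico 1 D)]
  refine sum_congr rfl fun k _ => ?_
  have h1 : ∀ a : ℕ, ψ (a + D * k : ℕ) = ψ a := fun a => by
    rw [← apply_mul_add_of_periodic h.1 k a]; congr 1; push_cast; ring
  simp only [h1]
  rw [sum_range_eq_sum_Ico_of_odd hD hodd]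
  simp only [mul_add (ψ _), sum_add_distrib]
  -- Reflecting only the terms `1/(n - z)` sends their poles to the negative side, and the sign from
  -- oddness makes them the other half of the cotangent pairs.
  rw [h.sum_Ico_reflect hodd (fun n => 1 / (((n + D * k : ℕ) : ℂ) - z)), ← sum_neg_distrib,
    ← sum_add_distrib]
  refine sum_congr rfl fun a ha => ?_
  rw [mem_Ico] at ha
  have e1 : (a + z) / D + k = (((a + D * k : ℕ) : ℂ) + z) / D := by
    push_cast; field_simp; ring
  have e2 : (a + z) / D - (k + 1) = -((((D - a + D * k : ℕ) : ℂ) - z) / D) := by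
    rw [Nat.cast_add, Nat.cast_sub ha.2.le]; push_cast; field_simp; ring
  rw [e1, e2, one_div_neg_eq_neg_one_div, one_div_div, one_div_div]
  field_simp

/-- The transformed series converges only conditionally, so it is truncated to whole periods: a sum
of `D * K` terms is `Φ` times `1 - q ^ (D K)`, dominated by `|Φ|`. As `t ≠ 0`, `z` is not real and
the cotangents have no poles. -/
theorem fourier_PhiTwisted_of_ne_zero (h : IsFourierEigen D ψ (I * Real.sqrt D)) (hD : 0 < D)
    (hodd : ∀ n, ψ (-n) = -ψ n) (hint : Integrable (PhiTwisted D ψ)) {t : ℝ} (ht : t ≠ 0) :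
    𝓕 (PhiTwisted D ψ) t = PhiTwisted D ψ t := by
  have hDR : (0 : ℝ) < D := by exact_mod_cast hD
  have hsR : 0 < Real.sqrt D := Real.sqrt_pos.2 hDR
  have hs : (Real.sqrt D : ℂ) ≠ 0 := by exact_mod_cast hsR.ne'
  have hss : (Real.sqrt D : ℂ) ^ 2 = D := by
    rw [← ofReal_pow, Real.sq_sqrt hDR.le, ofReal_natCast]
  have hπ : (Real.pi : ℂ) ≠ 0 := by exact_mod_cast Real.pi_pos.ne'
  set c : ℝ := 2 * Real.pi / Real.sqrt D with hc
  have hcpos : 0 < c := by have := Real.pi_pos; positivity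
  set k : ℝ → ℂ := fun x => cexp (2 * Real.pi * I * t * x) + cexp (-(2 * Real.pi * I * t * x))
    with hk
  have hkcont : Continuous k := by fun_prop
  have hknorm : ∀ x, ‖k x‖ ≤ 2 := by
    intro x
    have e1 : 2 * Real.pi * I * t * x = ((2 * Real.pi * t * x : ℝ) : ℂ) * I := by push_cast; ring
    have e2 : -(2 * Real.pi * I * t * x) = ((-(2 * Real.pi * t * x) : ℝ) : ℂ) * I := by
      push_cast; ring
    calc ‖k x‖ ≤ 1 + 1 := by
          refine (norm_add_le _ _).trans_eq ?_
          rw [e2, e1, norm_exp_ofReal_mul_I, norm_exp_ofReal_mul_I]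
      _ = 2 := by norm_num
  -- the Fourier integral as an integral over the half line
  have hF : 𝓕 (PhiTwisted D ψ) t = ∫ x in Set.Ioi (0 : ℝ), PhiTwisted D ψ x * k x := by
    rw [Real.fourier_real_eq_integral_exp_smul]
    set f : ℝ → ℂ := fun v => cexp (((-2 * Real.pi * v * t : ℝ) : ℂ) * I) • PhiTwisted D ψ v with hf
    have hfi : Integrable f := by
      refine hint.bdd_mul (c := 1) (by fun_prop) (Eventually.of_forall fun x => ?_)
      rw [norm_exp_ofReal_mul_I]
    rw [← integral_add_compl (measurableSet_Ioi (a := (0 : ℝ))) hfi, Set.compl_Ioi]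
    have h1 : ∫ x in Set.Iic (0 : ℝ), f x = ∫ x in Set.Ioi (0 : ℝ), f (-x) := by
      rw [integral_comp_neg_Ioi, neg_zero]
    rw [h1, ← integral_add hfi.integrableOn hfi.comp_neg.integrableOn]
    refine setIntegral_congr_fun measurableSet_Ioi fun x _ => ?_
    simp only [hf, hk, h.PhiTwisted_neg hD hodd, smul_eq_mul]
    rw [show ((-2 * Real.pi * x * t : ℝ) : ℂ) * I = -(2 * Real.pi * I * t * x) by push_cast; ring,
      show ((-2 * Real.pi * -x * t : ℝ) : ℂ) * I = 2 * Real.pi * I * t * x by push_cast; ring]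
    ring
  -- truncations of the geometric series
  set q : ℝ → ℝ := fun x => Real.exp (-(c * x)) with hq
  have hqlt : ∀ x ∈ Set.Ioi (0 : ℝ), q x ^ D < 1 := fun x hx =>
    pow_lt_one₀ (Real.exp_pos _).le (by
      rw [Real.exp_lt_one_iff, neg_lt_zero]; exact mul_pos hcpos hx) hD.ne'
  have hΦ : ∀ x ∈ Set.Ioi (0 : ℝ), PhiTwisted D ψ x = twistedQuotient D ψ (q x) := by
    intro x hx
    rw [← h.PhiTwisted_neg hD hodd, PhiTwisted_of_ne_zero hD (neg_ne_zero.2 (ne_of_gt hx))]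
    rw [show 2 * Real.pi * -x / Real.sqrt D = -(c * x) by rw [hc]; ring]
  set F : ℕ → ℝ → ℂ := fun K x => PhiTwisted D ψ x * (1 - (((q x ^ D) ^ K : ℝ) : ℂ)) * k x with hFdef
  have hqcont : Continuous q := by fun_prop
  have hlim : Tendsto (fun K => ∫ x in Set.Ioi (0 : ℝ), F K x) atTop
      (𝓝 (∫ x in Set.Ioi (0 : ℝ), PhiTwisted D ψ x * k x)) := by
    refine tendsto_integral_of_dominated_convergence (fun x => ‖PhiTwisted D ψ x‖ * 2) ?_
      (hint.norm.mul_const 2).integrableOn ?_ ?_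
    · intro K
      refine ((hint.aestronglyMeasurable.mul (Continuous.aestronglyMeasurable ?_)).mul
        hkcont.aestronglyMeasurable).restrict
      exact continuous_const.sub (continuous_ofReal.comp ((hqcont.pow D).pow K))
    · intro K
      filter_upwards [ae_restrict_mem measurableSet_Ioi] with x hx
      rw [hFdef, norm_mul, norm_mul]
      have h0 : 0 ≤ (q x ^ D) ^ K := pow_nonneg (pow_nonneg (Real.exp_pos _).le _) _
      have h1 : (q x ^ D) ^ K ≤ 1 := pow_le_one₀ (pow_nonneg (Real.exp_pos _).le _) (hqlt x hx).le
      have h2 : ‖(1 : ℂ) - (((q x ^ D) ^ K : ℝ) : ℂ)‖ ≤ 1 := by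
        rw [← ofReal_one, ← ofReal_sub, norm_real, Real.norm_of_nonneg (by linarith)]
        linarith
      calc _ ≤ ‖PhiTwisted D ψ x‖ * 1 * 2 := by gcongr; exact hknorm x
        _ = _ := by ring
    · filter_upwards [ae_restrict_mem measurableSet_Ioi] with x hx
      have h1 := (continuous_ofReal.tendsto _).comp (tendsto_pow_atTop_nhds_zero_of_lt_one
        (pow_nonneg (Real.exp_pos _).le D) (hqlt x hx))
      have h2 := ((h1.const_sub 1).const_mul (PhiTwisted D ψ x)).mul_const (k x)
      simpa [hFdef, Function.comp_def, hq] using h2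
  set z : ℂ := I * Real.sqrt D * t with hz
  have hFK : ∀ K, ∫ x in Set.Ioi (0 : ℝ), F K x = Real.sqrt D / (2 * Real.pi) *
      ∑ n ∈ range (D * K), ψ n * (1 / (n + z) + 1 / (n - z)) := by
    intro K
    have h1 : ∀ x ∈ Set.Ioi (0 : ℝ), F K x = ∑ n ∈ range (D * K),
        ψ n * (cexp (-((c * n : ℝ) * x)) * k x) := by
      intro x hx
      have hne : ((q x : ℝ) : ℂ) ^ D ≠ 1 := by exact_mod_cast (hqlt x hx).ne
      have := h.sum_range_pow hD hodd K hne
      simp only [hFdef]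
      rw [hΦ x hx, ofReal_pow, ofReal_pow, ← this, sum_mul]
      refine sum_congr rfl fun n _ => ?_
      rw [hq, ofReal_exp, ← exp_nat_mul, mul_assoc]
      congr 3
      push_cast; ring
    rw [setIntegral_congr_fun measurableSet_Ioi h1]
    have h2 : ∀ n : ℕ, n ≠ 0 → (0 : ℝ) < c * n := fun n hn => by positivity
    rw [integral_finsetSum]
    · rw [mul_sum]
      refine sum_congr rfl fun n _ => ?_
      rw [integral_const_mul]
      rcases eq_or_ne n 0 with rfl | hn
      · simp [apply_zero_of_odd hodd]
      · rw [(integral_exp_mul_cos (h2 n hn)).2]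
        have hc' : (c : ℂ) = 2 * Real.pi / Real.sqrt D := by rw [hc]; push_cast; rfl
        have e1 : ((c * n : ℝ) : ℂ) + 2 * Real.pi * t * I = 2 * Real.pi / Real.sqrt D * (n + z) := by
          rw [ofReal_mul, hc', hz, ofReal_natCast]; field_simp
        have e2 : ((c * n : ℝ) : ℂ) - 2 * Real.pi * t * I = 2 * Real.pi / Real.sqrt D * (n - z) := by
          rw [ofReal_mul, hc', hz, ofReal_natCast]; field_simp
        rw [e1, e2, ← one_div_mul_one_div, ← one_div_mul_one_div, one_div_div]
        ring
    · intro n _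
      rcases eq_or_ne n 0 with rfl | hn
      · simp [apply_zero_of_odd hodd]
      · exact (integral_exp_mul_cos (h2 n hn)).1.const_mul _
  have hzim : ∀ a : ℕ, ((a + z) / D).im ≠ 0 := by
    intro a
    have : (a + z) / D = ((a / D : ℝ) : ℂ) + ((Real.sqrt D * t / D : ℝ) : ℂ) * I := by
      rw [hz]; push_cast; ring
    rw [this, add_im, ofReal_im, mul_I_im, ofReal_re, zero_add]
    exact div_ne_zero (mul_ne_zero hsR.ne' ht) hDR.ne'
  have hcompl : ∀ a : ℕ, (a + z) / D ∈ integerComplement := by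
    rintro a ⟨n, hn⟩
    apply hzim a
    rw [← hn]; simp
  have hlim2 : Tendsto (fun K => ∫ x in Set.Ioi (0 : ℝ), F K x) atTop
      (𝓝 (Real.sqrt D / (2 * Real.pi) * (1 / D * ∑ a ∈ Ico 1 D, ψ a *
        (Real.pi * cot (Real.pi * ((a + z) / D)))))) := by
    simp only [hFK, h.sum_range_inv hD hodd]
    exact ((tendsto_finsetSum _ fun a _ =>
      (tendsto_sum_inv_add_inv (hcompl a)).const_mul _).const_mul _).const_mul _
  have hz1 : cexp (2 * Real.pi * I * z) ≠ 1 := by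
    have : 2 * Real.pi * I * z = ((-(2 * Real.pi * Real.sqrt D * t) : ℝ) : ℂ) := by
      rw [hz]; push_cast; linear_combination (2 * Real.pi * Real.sqrt D * t : ℂ) * I_sq
    rw [this, ← ofReal_exp, Ne, ofReal_eq_one, Real.exp_eq_one_iff, neg_eq_zero]
    have := Real.pi_pos
    positivity
  have hcot := sum_mul_cot h hD hodd hz1
  -- Here `e^(2πiz/D) = exp (-2πt/√D)`, so the value appears at `-t`; evenness brings it back to
  -- `t`.
  rw [hF, tendsto_nhds_unique hlim hlim2, ← h.PhiTwisted_neg hD hodd,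
    PhiTwisted_of_ne_zero hD (neg_ne_zero.2 ht)]
  have hqt : cexp (2 * Real.pi * I * (z / D)) =
      ((Real.exp (2 * Real.pi * -t / Real.sqrt D) : ℝ) : ℂ) := by
    rw [ofReal_exp]
    congr 1
    rw [hz, ← hss]; push_cast; field_simp
    linear_combination (t : ℂ) * I_sq
  rw [hqt] at hcot
  simp only [mul_left_comm _ (Real.pi : ℂ)]
  rw [← mul_sum, hcot]
  generalize twistedQuotient D ψ _ = Q
  -- The constants combine as `√D/(2π) · π/D · (-2i) · i√D = 1`.
  rw [← hss]
  field_simp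
  linear_combination -Q * I_sq

/-- The case `t = 0` follows by continuity: both sides are Schwartz and agree on a dense set. -/
theorem fourier_PhiTwisted (h : IsFourierEigen D ψ (I * Real.sqrt D)) (hD : 0 < D)
    (hodd : ∀ n, ψ (-n) = -ψ n) (t : ℝ) : 𝓕 (PhiTwisted D ψ) t = PhiTwisted D ψ t := by
  obtain ⟨f, hf⟩ := exists_schwartzMap_PhiTwisted hD (h.sum_Ico_eq_zero hD hodd)
  have hfun : PhiTwisted D ψ = f := funext fun x => (hf x).symm
  have hcont : Continuous (𝓕 (PhiTwisted D ψ)) := by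
    rw [hfun, ← SchwartzMap.fourier_coe]; exact (𝓕 f).continuous
  have hcont' : Continuous (PhiTwisted D ψ) := hfun ▸ f.continuous
  refine congrFun (Continuous.ext_on (dense_compl_singleton (0 : ℝ)) hcont hcont' fun x hx => ?_) t
  exact fourier_PhiTwisted_of_ne_zero h hD hodd (hfun ▸ f.integrable) hx

end FourierTransform

/-! ### From the periodic eigenfunction to the Kronecker symbol -/

/-- Only the values at `1, …, N - 1` enter, so agreement on positive integers suffices to exchange
the Kronecker symbol for the eigenfunction. -/
theorem twistedQuotient_congr {N : ℕ} {χ ψ : ℤ → ℂ} (h : ∀ n : ℕ, 0 < n → χ n = ψ n) :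
    twistedQuotient N χ = twistedQuotient N ψ := by
  ext t
  rw [twistedQuotient, twistedQuotient]
  congr 1
  exact Finset.sum_congr rfl fun n hn => by rw [h n (Finset.mem_Ico.1 hn).1]

theorem PhiTwisted_congr {N : ℕ} {χ ψ : ℤ → ℂ} (h : ∀ n : ℕ, 0 < n → χ n = ψ n) :
    PhiTwisted N χ = PhiTwisted N ψ := by
  ext x
  rw [PhiTwisted, PhiTwisted, phiTwisted, phiTwisted, twistedQuotient_congr h]

theorem corollary2p6 (K : Type*) [Field K] [NumberField K]
    (hdeg : Module.finrank ℚ K = 2) (himag : NumberField.IsTotallyComplex K)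
    (D : ℕ) (hD : NumberField.discr K = -(D : ℤ)) :
    (∃ f : 𝓢(ℝ, ℂ), ∀ x : ℝ, f x = PhiTwisted D (chiD D) x) ∧
      ∀ t : ℝ, 𝓕 (PhiTwisted D (chiD D)) t = PhiTwisted D (chiD D) t := by
  have hD0 : 0 < D := Nat.pos_of_ne_zero fun h0 => NumberField.discr_ne_zero K (by simp [hD, h0])
  have hneg : NumberField.discr K < 0 := by omega
  let b : Module.Basis (Fin 2) ℤ (NumberField.RingOfIntegers K) :=
    (Module.finBasis ℤ (NumberField.RingOfIntegers K)).reindex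
      (finCongr ((NumberField.RingOfIntegers.rank K).trans hdeg))
  have hmod := discr_quadratic_mod_four b
  have hfund := fun f d => sq_eq_one_of_discr_eq_sq_mul b hneg (f := f) (d := d)
  rw [hD] at hmod
  simp only [hD] at hfund
  obtain ⟨ψ, hψ, hodd, hχ⟩ := exists_isFourierEigen_chiD hmod hfund
  rw [PhiTwisted_congr hχ]
  exact ⟨exists_schwartzMap_PhiTwisted hD0 (hψ.sum_Ico_eq_zero hD0 hodd),
    fourier_PhiTwisted hψ hD0 hodd⟩
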